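/- **Theorem (Circular domains).** Let $\mathcal E,h,\mu,\omega\in\mathbb R$ with $\mu>0$, $\omega>0$, $\mathcal E+h>0$, $\mathcal E>\omega^2/2$. In the plane $\mathbb R^2\cong\mathbb C$ let $$V_E(z)=\mathcal E-\tfrac{\omega^2}{2}|z|^2\ (\text{outside the open unit disk }D),\qquad V_I(z)=\mathcal E+h+\tfrac{\mu}{|z|}\ (\text{inside }D),$$ and assume $V_E<V_I$ on $\partial D$. An *outer arc* is a solution on some $[0,T]$, $T>0$, of $z''=\nabla V_E(z)$, $\frac12|z'|^2=V_E(z)$, with endpoints on $\partial D$ and $|z|>1$ on $(0,T)$. An *inner arc* is a solution of $z''=\nabla V_I(z)$, $\frac12|z'|^2=V_I(z)$, with endpoints on $\partial D$ and $|z|<1$ on $(0,T)$, either classical ($z\neq0$ throughout) or an ejection-collision solution (it reaches $0$ exactly at time $T/2$ and then retraces its path). At a crossing $p\in\partial D$ outer and inner velocities $v_E,v_I$ are related by Snell's law $\sqrt{V_E(p)}\,\frac{v_E}{|v_E|}\cdot t=\sqrt{V_I(p)}\,\frac{v_I}{|v_I|}\cdot t$, where $t=ip$ is the unit tangent. The first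 return map acts on the states $(p,v)$ with $|p|=1$, $\frac12|v|^2=V_E(p)$, $v\cdot p>0$: it sends the initial state of an outer arc, followed by a refraction into $D$, an inner arc and a refraction out of $D$, to the resulting outgoing state. Such a concatenation is called an excursion; its Jacobi length is the sum of $\int|z'|\sqrt{V_E(z)}\,ds$ over its outer arc and $\int|z'|\sqrt{V_I(z)}\,ds$ over its inner arc. Put $I_c=\sqrt{\mathcal E-\omega^2/2}$ and $\mathcal I=(-I_c,I_c)$. For $I\in\mathcal I$ let $\bar\theta(I)=f(I)+g(I)$, where $f(0)=g(0)=0$ and, with $\operatorname{arccot}$ valued in $(0,\pi)$, $$f(I)=\operatorname{arccot}\Big(\frac{\mathcal E-2I^2}{I\sqrt{4\mathcal E-2(2I^2+\omega^2)}}\Big)\ (I>0),\qquad f(I)=\operatorname{arccot}\Big(\frac{\mathcal E-2I^2}{I\sqrt{4\mathcal E-2(2I^2+\omega^2)}}\Big)-\pi\ (I<0),$$ $$g(I)=\pm\Big(2\arccos\Big(\frac{2I^2-\mu}{\sqrt{4(\mathcal E+h)I^2+\mu^2}}\Big)-2\pi\Big)\quad(\pm I>0).$$ Then: 1. The polar angle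 $\xi$ of $p$ and the action $I=\frac1{\sqrt2}\,v\cdot t$ define a homeomorphism from the space of states onto $\mathbb R/2\pi\mathbb Z\times\mathcal I$. The first return map is well defined on all states, and in these coordinates it is the shift $$\mathcal F(\xi_0,I_0)=(\xi_0+\bar\theta(I_0),\,I_0).$$ 2. Modulo $2\pi$, $f(I_0)$ is the change of polar angle along the outer arc and $g(I_0)$ the change along the inner arc. 3. The coordinates are canonical: if $\bar\theta'(I_0)\ne0$, then near $(\xi_0,\xi_0+\bar\theta(I_0))$ there is a function $S$ of (lifted) polar angles, defined by letting $S(\xi,\xi')$ be the Jacobi length of the excursions from angle $\xi$ to angle $\xi'$ with initial action near $I_0$ (such excursions exist), and the initial and final actions of these excursions are $-\partial_{\xi}S$ and $\partial_{\xi'}S$. 4. $f$ and $g$ are real analytic on $\mathcal I$. 5. There is a real polynomial $P$ of degree $5$ such that $P(I^2)=0$ for every $I\in\mathcal I$ with $\bar\theta'(I)=0$; and $\bar\theta'(I)\neq0$ for all $I\in\mathcal I$ except at most ten points. -/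

import Mathlib

open Set Filter Topology

noncomputable section

namespace RefractiveBilliard

/-! The plane is `ℂ`, regarded as the real Euclidean plane; the interface is the unit circle.
The physical parameters are `E` (outer energy), `h` (energy jump), `μ` (mass parameter of the
Keplerian center) and `ω` (frequency of the harmonic oscillator). -/

/-- The inner (Keplerian) potential. -/
def VI (E h μ : ℝ) (z : ℂ) : ℝ := E + h + μ / ‖z‖

/-- The outer (harmonic) potential. -/
def VE (E ω : ℝ) (z : ℂ) : ℝ := E - ω ^ 2 / 2 * ‖z‖ ^ 2

/-- `z`, with velocity `v`, is a zero-energy solution on `J` of `z'' = ∇V(z)`,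
`|z'|² / 2 - V(z) = 0`. -/
structure SolvesOn (V : ℂ → ℝ) (J : Set ℝ) (z v : ℝ → ℂ) : Prop where
  velocity : ∀ s ∈ J, HasDerivWithinAt z (v s) J s
  newton : ∀ s ∈ J, HasDerivWithinAt v (gradient V (z s)) J s
  energy : ∀ s ∈ J, ‖v s‖ ^ 2 / 2 - V (z s) = 0

/-- An outer arc: it solves the outer problem on `[0, T]`, has both endpoints on the unit circle,
and stays outside the closed unit disk in between. -/
structure IsOuterArc (E ω T : ℝ) (z v : ℝ → ℂ) : Prop where
  pos : 0 < T
  start : ‖z 0‖ = 1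
  finish : ‖z T‖ = 1
  outside : ∀ s ∈ Ioo 0 T, 1 < ‖z s‖
  solves : SolvesOn (VE E ω) (Icc 0 T) z v

/-- A classical solution of the inner problem on `[0, T]`: it never meets the center. -/
def IsClassicalInner (E h μ T : ℝ) (z v : ℝ → ℂ) : Prop :=
  (∀ s ∈ Icc 0 T, z s ≠ 0) ∧ SolvesOn (VI E h μ) (Icc 0 T) z v

/-- An ejection-collision solution of the inner problem on `[0, T]`: it falls into the center at
the time `T / 2`, solves the inner problem at all other times, and after the collision it
travels its path backwards. -/
structure IsEjectionCollision (E h μ T : ℝ) (z v : ℝ → ℂ) : Prop where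
  continuousOn : ContinuousOn z (Icc 0 T)
  collision : ∀ s ∈ Icc 0 T, z s = 0 ↔ s = T / 2
  solves : SolvesOn (VI E h μ) (Icc 0 T \ {T / 2}) z v
  bounce : ∀ s ∈ Icc 0 T, z (T - s) = z s

/-- An inner arc: a classical or an ejection-collision solution of the inner problem on `[0, T]`
with both endpoints on the unit circle, which stays in the open unit disk in between. -/
structure IsInnerArc (E h μ T : ℝ) (z v : ℝ → ℂ) : Prop where
  pos : 0 < T
  start : ‖z 0‖ = 1
  finish : ‖z T‖ = 1
  inside : ∀ s ∈ Ioo 0 T, ‖z s‖ < 1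
  solves : IsClassicalInner E h μ T z v ∨ IsEjectionCollision E h μ T z v

/-- The positively oriented unit tangent vector to the unit circle at `p`. -/
def tangent (p : ℂ) : ℂ := Complex.I * p

/-- The generalized Snell law at the point `p` of the interface, between the outer velocity `vE`
and the inner velocity `vI`. -/
def Snell (E h μ ω : ℝ) (p vE vI : ℂ) : Prop :=
  √(VE E ω p) * inner ℝ (‖vE‖⁻¹ • vE) (tangent p) =
    √(VI E h μ p) * inner ℝ (‖vI‖⁻¹ • vI) (tangent p)

/-- The phase space of the first return map: pairs (position, velocity) with the position
on the unit circle and the velocity on the zero energy level of the outer problem, pointing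
(transversally) towards the exterior of the disk. -/
abbrev OutState (E ω : ℝ) : Type :=
  {x : ℂ × ℂ // ‖x.1‖ = 1 ∧ ‖x.2‖ ^ 2 / 2 - VE E ω x.1 = 0 ∧ 0 < inner ℝ x.1 x.2}

/-- An excursion from the state `x` to the state `y`: an outer arc issued from `x`, the refraction
into the disk, an inner arc, and the refraction out of the disk into the state `y`. -/
structure Excursion (E h μ ω : ℝ) (x y : OutState E ω) where
  /-- duration of the outer arc -/
  TE : ℝ
  /-- duration of the inner arc -/
  TI : ℝ
  /-- position along the outer arc -/
  zE : ℝ → ℂ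
  /-- velocity along the outer arc -/
  vE : ℝ → ℂ
  /-- position along the inner arc -/
  zI : ℝ → ℂ
  /-- velocity along the inner arc -/
  vI : ℝ → ℂ
  outer : IsOuterArc E ω TE zE vE
  inner_arc : IsInnerArc E h μ TI zI vI
  start_pos : zE 0 = x.1.1
  start_vel : vE 0 = x.1.2
  crossing : zI 0 = zE TE
  snell_in : Snell E h μ ω (zE TE) (vE TE) (vI 0)
  end_pos : zI TI = y.1.1
  snell_out : Snell E h μ ω (zI TI) y.1.2 (vI TI)

/-- The Jacobi length `∫ |z'| √V` of an arc of duration `T`. -/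
def jacobiLength (V : ℂ → ℝ) (T : ℝ) (z v : ℝ → ℂ) : ℝ :=
  ∫ s in (0 : ℝ)..T, ‖v s‖ * √(V (z s))

/-- The Jacobi length of an excursion: the sum of those of its outer and of its inner arc. -/
def Excursion.length {E h μ ω : ℝ} {x y : OutState E ω} (X : Excursion E h μ ω x y) : ℝ :=
  jacobiLength (VE E ω) X.TE X.zE X.vE + jacobiLength (VI E h μ) X.TI X.zI X.vI

/-- The polar angle of a point of the plane, as an element of `ℝ / 2πℤ`. -/
def polarAngle (z : ℂ) : Real.Angle := (Complex.arg z : Real.Angle)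

/-- The action of a state: `√V_E` times the sine of the angle from the outward normal to
the velocity, that is, `1 / √2` times the tangential component of the velocity. -/
def action {E ω : ℝ} (x : OutState E ω) : ℝ := inner ℝ x.1.2 (tangent x.1.1) / √2

/-- The critical action (total reflection). -/
def Ic (E ω : ℝ) : ℝ := √(E - ω ^ 2 / 2)

/-- `S` is on `W` the generating function of the excursions with initial action in `J`:
two (lifted) polar angles `(a, b)` in `W` are joined by such an excursion, `S (a, b)` is the Jacobi
length of every such excursion, and `∂_a S = - I₀`, `∂_b S = I₁`, where `I₀` and `I₁` are
the actions of the initial and of the final state. -/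
structure IsGeneratingFunction (E h μ ω : ℝ) (J : Set ℝ) (W : Set (ℝ × ℝ)) (S : ℝ × ℝ → ℝ) :
    Prop where
  exists_excursion : ∀ q ∈ W, ∃ x y : OutState E ω, Nonempty (Excursion E h μ ω x y) ∧
    polarAngle x.1.1 = (q.1 : Real.Angle) ∧ polarAngle y.1.1 = (q.2 : Real.Angle) ∧ action x ∈ J
  length_eq : ∀ q ∈ W, ∀ (x y : OutState E ω) (X : Excursion E h μ ω x y),
    polarAngle x.1.1 = (q.1 : Real.Angle) → polarAngle y.1.1 = (q.2 : Real.Angle) →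
    action x ∈ J → S q = X.length
  canonical : ∀ q ∈ W, ∀ (x y : OutState E ω), Nonempty (Excursion E h μ ω x y) →
    polarAngle x.1.1 = (q.1 : Real.Angle) → polarAngle y.1.1 = (q.2 : Real.Angle) →
    action x ∈ J →
    HasFDerivAt S (-(action x) • ContinuousLinearMap.fst ℝ ℝ ℝ
      + action y • ContinuousLinearMap.snd ℝ ℝ ℝ) q

/-- The inverse cotangent, with values in `(0, π)`. -/
def arccot (x : ℝ) : ℝ := Real.pi / 2 - Real.arctan x

/-- The outer shift. -/
def f (E ω I : ℝ) : ℝ :=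
  if 0 < I then arccot ((E - 2 * I ^ 2) / (I * √(4 * E - 2 * (2 * I ^ 2 + ω ^ 2))))
  else if I = 0 then 0
  else arccot ((E - 2 * I ^ 2) / (I * √(4 * E - 2 * (2 * I ^ 2 + ω ^ 2)))) - Real.pi

/-- The inner shift. -/
def g (E h μ I : ℝ) : ℝ :=
  if 0 < I then
    2 * Real.arccos ((2 * I ^ 2 - μ) / √(4 * (E + h) * I ^ 2 + μ ^ 2)) - 2 * Real.pi
  else if I = 0 then 0
  else -2 * Real.arccos ((2 * I ^ 2 - μ) / √(4 * (E + h) * I ^ 2 + μ ^ 2)) + 2 * Real.pi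

/-- The total shift. -/
def thetaBar (E h μ ω I : ℝ) : ℝ := f E ω I + g E h μ I

end RefractiveBilliard

end

noncomputable section

namespace RefractiveBilliard

open ComplexConjugate

/-! ### Potentials, tangential components, Snell's law -/

/-! Everything is read off the complex momentum `conj z * v`, whose real part is the radial and
whose imaginary part is the angular momentum. Both potentials are radial, so the angular momentum is
constant along each arc. On the zero-energy levels Snell's law says exactly that the tangential
velocity is continuous at a crossing (`snell_iff`). Hence the action `I` survives an excursion, and
the position is multiplied by a unit complex number depending only on `I`.

Outside, the oscillator is solved explicitly, and `|z|² - 1` is a product of two sines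
(`norm_sq_outer_point`), which locates the return to the circle (`IsOuterArc.end_data`). Inside, the
momentum has the real derivative `2 (E + h) + μ / |z|` and stays continuous through a collision. A
rescaled `arsinh` of its real part is the hyperbolic anomaly `kepParam`, so classical and
ejection-collision arcs are mostly treated together. Kepler's equation gives their duration and
length, and comparison with the model `kepCurve` gives the endpoint (`IsInnerArc.end_point`).

Both rotations are governed by the argument of `shiftDir A B I`, taken once for the outer arc and
`-2` times for the inner arc. This number never leaves the slit plane, so the piecewise formulas for
`f` and `g` glue to analytic functions across `I = 0`, with explicit derivatives.

The length `ℓ(I)` of an excursion satisfies `ℓ' = I θ'`, where `θ = thetaBar`. Where `θ' ≠ 0`, the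
function `S(a, b) = ℓ(θ⁻¹(b - a))` therefore has `dS = I (db - da)`, which is the generating
property. Finally `θ' = 0` equates two expressions with one square root each; squaring gives a
quintic in `I²`, and each of its roots accounts for at most two values of `I`. -/

lemma hasGradientAt_VE (E ω : ℝ) (z : ℂ) :
    HasGradientAt (VE E ω) (-(ω ^ 2 : ℂ) * z) z := by
  rw [hasGradientAt_iff_hasFDerivAt]
  have h := ((hasStrictFDerivAt_norm_sq z).hasFDerivAt.const_mul (ω ^ 2 / 2)).const_sub E
  refine h.congr_fderiv ?_
  ext w
  simp [Complex.inner, ← Complex.ofReal_pow]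
  ring

lemma hasGradientAt_VI (E h μ : ℝ) {z : ℂ} (hz : z ≠ 0) :
    HasGradientAt (VI E h μ) (-(μ / ‖z‖ ^ 3 : ℂ) * z) z := by
  rw [hasGradientAt_iff_hasFDerivAt]
  have hz' : ‖z‖ ≠ 0 := norm_ne_zero_iff.mpr hz
  have h1 := (hasStrictFDerivAt_norm_sq z).hasFDerivAt.sqrt (pow_ne_zero 2 hz')
  have h2 := (hasDerivAt_inv (x := √(‖z‖ ^ 2)) (by simpa using hz')).comp_hasFDerivAt z h1
  have h3 := (h2.const_mul μ).const_add (E + h)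
  have h4 : HasFDerivAt (VI E h μ) _ z := h3.congr_of_eventuallyEq
    (Eventually.of_forall fun w => by simp [VI, div_eq_mul_inv])
  refine h4.congr_fderiv ?_
  have h5 : -((μ : ℂ) / ‖z‖ ^ 3) * z = ((-(μ / ‖z‖ ^ 3) : ℝ) : ℂ) * z := by push_cast; ring
  rw [h5]
  obtain ⟨c, hc⟩ : ∃ c : ℝ, c = -(μ / ‖z‖ ^ 3) := ⟨_, rfl⟩
  rw [← hc]
  ext w
  simp [Complex.inner, smul_smul]
  rw [hc]
  field_simp
  ring

lemma gradient_VE (E ω : ℝ) (z : ℂ) : gradient (VE E ω) z = -(ω ^ 2 : ℂ) * z :=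
  (hasGradientAt_VE E ω z).gradient

lemma gradient_VI (E h μ : ℝ) {z : ℂ} (hz : z ≠ 0) :
    gradient (VI E h μ) z = -(μ / ‖z‖ ^ 3 : ℂ) * z :=
  (hasGradientAt_VI E h μ hz).gradient

/-- Together with `inner_eq_re`, this replaces inner products by the two components of `conj p * v`,
which can then be handled by complex algebra. -/
lemma inner_tangent (p v : ℂ) : inner ℝ v (tangent p) = (conj p * v).im := by
  simp [Complex.inner, tangent]; ring

lemma inner_eq_re (p v : ℂ) : inner ℝ p v = (conj p * v).re := by
  simp [Complex.inner]; ring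

lemma eq_conj_mul_mul {p : ℂ} (hp : ‖p‖ = 1) (v : ℂ) : v = conj p * v * p := by
  have : conj p * p = 1 := by rw [Complex.conj_mul', hp]; simp
  linear_combination (-v) * this

lemma VE_of_norm_one (E ω : ℝ) {p : ℂ} (hp : ‖p‖ = 1) : VE E ω p = E - ω ^ 2 / 2 := by
  simp [VE, hp]

lemma VI_of_norm_one (E h μ : ℝ) {p : ℂ} (hp : ‖p‖ = 1) : VI E h μ p = E + h + μ := by
  simp [VI, hp]

/-- The Jacobi length density of a zero-energy motion. -/
lemma norm_mul_sqrt_of_energy {V : ℝ} {v : ℂ} (h : ‖v‖ ^ 2 / 2 - V = 0) :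
    ‖v‖ * √V = √2 * V := by
  have hV : V = ‖v‖ ^ 2 / 2 := by linarith
  rw [hV, Real.sqrt_div (by positivity), Real.sqrt_sq (norm_nonneg v)]
  field_simp
  rw [Real.sq_sqrt (by norm_num)]

/-- Zero energy means `‖v‖ = √2 √V`, so the weight `√V` cancels the normalization of the velocity up
to `√2`. This turns Snell's law into equality of tangential components. -/
lemma sqrt_mul_inner_of_energy {V : ℝ} (hV : 0 < V) {p v : ℂ} (h : ‖v‖ ^ 2 / 2 - V = 0) :
    √V * inner ℝ (‖v‖⁻¹ • v) (tangent p) = (conj p * v).im / √2 := by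
  have hv : ‖v‖ = √2 * √V := by
    rw [← Real.sqrt_mul (by norm_num), show 2 * V = ‖v‖ ^ 2 by linarith,
      Real.sqrt_sq (norm_nonneg v)]
  have := Real.sqrt_pos.mpr hV
  rw [real_inner_smul_left, inner_tangent, hv]
  field_simp

lemma snell_iff {E h μ ω : ℝ} {p vE vI : ℂ} (hVE : 0 < VE E ω p) (hVI : 0 < VI E h μ p)
    (h1 : ‖vE‖ ^ 2 / 2 - VE E ω p = 0) (h2 : ‖vI‖ ^ 2 / 2 - VI E h μ p = 0) :
    Snell E h μ ω p vE vI ↔ (conj p * vE).im = (conj p * vI).im := by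
  rw [Snell, sqrt_mul_inner_of_energy hVE h1, sqrt_mul_inner_of_energy hVI h2,
    div_left_inj' (by positivity)]

lemma action_eq {E ω : ℝ} (x : OutState E ω) : action x = (conj x.1.1 * x.1.2).im / √2 := by
  rw [action, inner_tangent]

/-! ### Polar angle and action-angle coordinates. -/

lemma polarAngle_mul {z w : ℂ} (hz : z ≠ 0) (hw : w ≠ 0) :
    polarAngle (z * w) = polarAngle z + polarAngle w :=
  Complex.arg_mul_coe_angle hz hw

lemma polarAngle_mul_ofReal (z : ℂ) {r : ℝ} (hr : 0 < r) :
    polarAngle (z * r) = polarAngle z := by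
  rw [polarAngle, mul_comm, Complex.arg_real_mul _ hr, polarAngle]

/-- The radial component of the outer velocity of the states of action `I`. -/
def radialVelocity (E ω I : ℝ) : ℝ := √(2 * E - ω ^ 2 - 2 * I ^ 2)

lemma mem_Ioo_Ic_iff {E ω I : ℝ} :
    I ∈ Ioo (-Ic E ω) (Ic E ω) ↔ 2 * I ^ 2 < 2 * E - ω ^ 2 := by
  rw [mem_Ioo, ← abs_lt, Ic, Real.lt_sqrt (abs_nonneg I), sq_abs]
  constructor <;> intro h <;> linarith

lemma radialVelocity_pos {E ω I : ℝ} (hI : I ∈ Ioo (-Ic E ω) (Ic E ω)) :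
    0 < radialVelocity E ω I := by
  rw [mem_Ioo_Ic_iff] at hI
  exact Real.sqrt_pos.mpr (by linarith)

lemma radialVelocity_sq {E ω I : ℝ} (hI : I ∈ Ioo (-Ic E ω) (Ic E ω)) :
    radialVelocity E ω I ^ 2 + (√2 * I) ^ 2 = 2 * E - ω ^ 2 := by
  rw [mem_Ioo_Ic_iff] at hI
  rw [radialVelocity, Real.sq_sqrt (by linarith), mul_pow, Real.sq_sqrt (by norm_num)]
  ring

lemma OutState.pos_ne_zero {E ω : ℝ} (x : OutState E ω) : x.1.1 ≠ 0 := by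
  rw [← norm_pos_iff, x.2.1]; exact one_pos

lemma OutState.re_sq_add {E ω : ℝ} (x : OutState E ω) :
    (conj x.1.1 * x.1.2).re ^ 2 + 2 * action x ^ 2 = 2 * E - ω ^ 2 := by
  have h1 : ‖conj x.1.1 * x.1.2‖ ^ 2 = 2 * E - ω ^ 2 := by
    have h := x.2.2.1
    rw [VE_of_norm_one E ω x.2.1] at h
    rw [norm_mul, Complex.norm_conj, x.2.1, one_mul]; linarith
  rw [Complex.sq_norm, Complex.normSq_apply] at h1
  rw [action_eq, div_pow, Real.sq_sqrt (by norm_num)]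
  linarith

lemma OutState.action_mem {E ω : ℝ} (x : OutState E ω) :
    action x ∈ Ioo (-Ic E ω) (Ic E ω) := by
  rw [mem_Ioo_Ic_iff]
  have h := x.re_sq_add
  have h2 := x.2.2.2
  rw [inner_eq_re] at h2
  nlinarith

/-- The energy fixes the radial component up to sign, and the outgoing condition selects the
positive root. -/
lemma OutState.vel_eq {E ω : ℝ} (x : OutState E ω) :
    x.1.2 = (radialVelocity E ω (action x) + (√2 * action x : ℝ) * Complex.I) * x.1.1 := by
  have h := x.re_sq_add
  have h2 := x.2.2.2
  rw [inner_eq_re] at h2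
  have h3 : radialVelocity E ω (action x) = (conj x.1.1 * x.1.2).re := by
    rw [radialVelocity, ← Real.sqrt_sq h2.le]; congr 1; linarith
  have h4 : √2 * action x = (conj x.1.1 * x.1.2).im := by
    rw [action_eq]; field_simp
  rw [h3, h4, Complex.re_add_im]
  exact eq_conj_mul_mul x.2.1 _

/-- The outgoing state with given position and action. -/
def mkState {E ω : ℝ} (p : ℂ) (hp : ‖p‖ = 1) (I : ℝ)
    (hI : I ∈ Ioo (-Ic E ω) (Ic E ω)) : OutState E ω :=
  ⟨(p, (radialVelocity E ω I + (√2 * I : ℝ) * Complex.I) * p), hp, by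
    rw [VE_of_norm_one E ω hp, norm_mul, hp, mul_one, Complex.sq_norm,
      Complex.normSq_add_mul_I, radialVelocity_sq hI]; ring, by
    have h1 : conj p * p = 1 := by rw [Complex.conj_mul', hp]; simp
    rw [inner_eq_re, mul_comm _ p, ← mul_assoc, h1]
    simpa using radialVelocity_pos hI⟩

lemma action_mkState {E ω : ℝ} (p : ℂ) (hp : ‖p‖ = 1) (I : ℝ)
    (hI : I ∈ Ioo (-Ic E ω) (Ic E ω)) : action (mkState p hp I hI) = I := by
  have h1 : conj p * p = 1 := by rw [Complex.conj_mul', hp]; simp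
  rw [action_eq, mkState]
  simp only
  rw [mul_comm _ p, ← mul_assoc, h1]
  simp

lemma polarAngle_toCircle (ξ : Real.Angle) : polarAngle (ξ.toCircle : ℂ) = ξ := by
  simp [polarAngle]

lemma toCircle_polarAngle {p : ℂ} (hp : ‖p‖ = 1) : ((polarAngle p).toCircle : ℂ) = p := by
  have hp0 : p ≠ 0 := by rw [← norm_pos_iff, hp]; exact one_pos
  rw [polarAngle, Real.Angle.toCircle_coe, Circle.coe_exp]
  have := Complex.norm_mul_exp_arg_mul_I p
  rwa [hp, Complex.ofReal_one, one_mul] at this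

lemma continuous_toCircle : Continuous Real.Angle.toCircle :=
  continuous_quot_lift _ Circle.exp.continuous

/-- The action-angle coordinates. -/
def actionAngle {E ω : ℝ} :
    OutState E ω ≃ₜ Real.Angle × Ioo (-Ic E ω) (Ic E ω) where
  toFun x := (polarAngle x.1.1, ⟨action x, x.action_mem⟩)
  invFun y := mkState y.1.toCircle (Circle.norm_coe _) y.2 y.2.2
  left_inv x := by
    apply Subtype.ext
    simp only [mkState, toCircle_polarAngle x.2.1]
    rw [← x.vel_eq]
  right_inv y := by
    refine Prod.ext ?_ (Subtype.ext ?_)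
    · exact polarAngle_toCircle _
    · exact action_mkState _ _ _ _
  continuous_toFun := by
    refine Continuous.prodMk ?_ (Continuous.subtype_mk ?_ _)
    -- As a map to `ℝ / 2πℤ`, the argument has no branch cut: it is continuous away from `0`.
    · refine continuous_iff_continuousAt.mpr fun x => ?_
      exact (Complex.continuousAt_arg_coe_angle x.pos_ne_zero).comp
        (f := fun x : OutState E ω => x.1.1) (by fun_prop)
    · have h : (action : OutState E ω → ℝ) =
          fun x => (conj x.1.1 * x.1.2).im / √2 := funext action_eq
      rw [h]
      fun_prop
  continuous_invFun := by
    refine Continuous.subtype_mk ?_ _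
    have h1 : Continuous fun y : Real.Angle × Ioo (-Ic E ω) (Ic E ω) => (y.1.toCircle : ℂ) :=
      continuous_subtype_val.comp ((continuous_toCircle).comp continuous_fst)
    simp only [radialVelocity]
    fun_prop

section

/-! ### The shifts as arguments of complex numbers -/

/-- A complex number of modulus `√(A ^ 2 + 4 (B - A) I ^ 2)` whose argument gives the shifts. -/
def shiftDir (A B I : ℝ) : ℂ :=
  (A - 2 * I ^ 2 : ℝ) + (2 * I * √(B - I ^ 2) : ℝ) * Complex.I

lemma shiftDir_re (A B I : ℝ) : (shiftDir A B I).re = A - 2 * I ^ 2 := by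
  simp only [shiftDir, Complex.add_re, Complex.re_ofReal_mul, Complex.ofReal_re, Complex.I_re]
  ring

lemma shiftDir_im (A B I : ℝ) : (shiftDir A B I).im = 2 * I * √(B - I ^ 2) := by
  simp only [shiftDir, Complex.add_im, Complex.im_ofReal_mul, Complex.ofReal_im, Complex.I_im]
  ring

variable {A B I : ℝ}

lemma normSq_shiftDir (hB : I ^ 2 < B) :
    Complex.normSq (shiftDir A B I) = A ^ 2 + 4 * (B - A) * I ^ 2 := by
  have h := Real.sq_sqrt (sub_pos.mpr hB).le
  rw [Complex.normSq_apply, shiftDir_re, shiftDir_im]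
  linear_combination 4 * I ^ 2 * h

lemma norm_shiftDir (hB : I ^ 2 < B) :
    ‖shiftDir A B I‖ = √(A ^ 2 + 4 * (B - A) * I ^ 2) := by
  rw [Complex.norm_def, normSq_shiftDir hB]

/-- The imaginary part vanishes only at `I = 0`, where the real part is `A > 0`. The branch cut of
`arg` is thus avoided, which makes the shifts analytic at `I = 0` as well. -/
lemma shiftDir_mem_slitPlane (hA : 0 < A) (hB : I ^ 2 < B) :
    shiftDir A B I ∈ Complex.slitPlane := by
  rw [Complex.mem_slitPlane_iff, shiftDir_re, shiftDir_im]
  rcases eq_or_ne I 0 with rfl | hI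
  · left; simpa using hA
  · right
    have := Real.sqrt_pos.mpr (sub_pos.mpr hB)
    positivity

lemma shiftDir_ne_zero (hA : 0 < A) (hB : I ^ 2 < B) : shiftDir A B I ≠ 0 :=
  Complex.slitPlane_ne_zero (shiftDir_mem_slitPlane hA hB)

lemma shift_modulus_pos (hA : 0 < A) (hB : I ^ 2 < B) : 0 < A ^ 2 + 4 * (B - A) * I ^ 2 := by
  rw [← normSq_shiftDir hB]
  exact Complex.normSq_pos.mpr (shiftDir_ne_zero hA hB)

lemma arg_eq_of_eq {z : ℂ} {r θ : ℝ} (hr : 0 < r) (hθ : θ ∈ Ioc (-Real.pi) Real.pi)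
    (hre : z.re = r * Real.cos θ) (him : z.im = r * Real.sin θ) : Complex.arg z = θ := by
  have hz : z = r * (Complex.cos θ + Complex.sin θ * Complex.I) := by
    rw [← Complex.ofReal_cos, ← Complex.ofReal_sin]
    apply Complex.ext
    · simp [hre, -Complex.ofReal_cos, -Complex.ofReal_sin]
    · simp [him, -Complex.ofReal_cos, -Complex.ofReal_sin]
  rw [hz, Complex.arg_mul_cos_add_sin_mul_I hr hθ]

lemma arg_eq_arccot {z : ℂ} (hz : 0 < z.im) : Complex.arg z = arccot (z.re / z.im) := by
  have h1 := Real.arctan_lt_pi_div_two (z.re / z.im)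
  have h2 := Real.neg_pi_div_two_lt_arctan (z.re / z.im)
  have h3 : 0 < √(1 + (z.re / z.im) ^ 2) := Real.sqrt_pos.mpr (by positivity)
  refine arg_eq_of_eq (r := z.im * √(1 + (z.re / z.im) ^ 2)) (by positivity)
    ⟨by unfold arccot; linarith, by unfold arccot; linarith⟩ ?_ ?_
  · rw [arccot, Real.cos_pi_div_two_sub, Real.sin_arctan]
    field_simp
  · rw [arccot, Real.sin_pi_div_two_sub, Real.cos_arctan]
    field_simp

lemma arg_eq_arccot_sub {z : ℂ} (hz : z.im < 0) :
    Complex.arg z = arccot (z.re / z.im) - Real.pi := by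
  have h1 := Complex.arg_neg_eq_arg_add_pi_of_im_neg hz
  have h2 := arg_eq_arccot (z := -z) (by simpa using hz)
  rw [Complex.neg_re, Complex.neg_im, neg_div_neg_eq] at h2
  linarith

/-- The argument of `shiftDir`. -/
def shiftArg (A B I : ℝ) : ℝ := Complex.arg (shiftDir A B I)

/-- The sign of `I` is the sign of the imaginary part of `shiftDir`, so the three cases in the
definition are the upper half-plane, the positive real axis and the lower half-plane for one branch
of `arg`. -/
lemma f_eq {E ω I : ℝ} (hE : ω ^ 2 / 2 < E) (hI : I ^ 2 < E - ω ^ 2 / 2) :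
    f E ω I = shiftArg E (E - ω ^ 2 / 2) I := by
  have hs := Real.sqrt_pos.mpr (sub_pos.mpr hI)
  have h4 : √(4 * E - 2 * (2 * I ^ 2 + ω ^ 2)) = 2 * √(E - ω ^ 2 / 2 - I ^ 2) := by
    rw [show 4 * E - 2 * (2 * I ^ 2 + ω ^ 2) = 2 ^ 2 * (E - ω ^ 2 / 2 - I ^ 2) by ring,
      Real.sqrt_mul (by norm_num), Real.sqrt_sq (by norm_num)]
  have h5 : (E - 2 * I ^ 2) / (I * √(4 * E - 2 * (2 * I ^ 2 + ω ^ 2))) =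
      (shiftDir E (E - ω ^ 2 / 2) I).re / (shiftDir E (E - ω ^ 2 / 2) I).im := by
    rw [h4, shiftDir_re, shiftDir_im]; congr 1; ring
  unfold f shiftArg
  split_ifs with h1 h2
  · rw [h5, arg_eq_arccot]
    rw [shiftDir_im]; positivity
  · subst h2
    have hE0 : 0 < E := by nlinarith [sq_nonneg ω]
    rw [shiftDir]
    simp [Complex.arg_ofReal_of_nonneg hE0.le]
  · rw [h5, arg_eq_arccot_sub]
    rw [shiftDir_im]
    have : I < 0 := lt_of_le_of_ne (not_lt.mp h1) h2
    nlinarith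

/-- The identity `arccos (-x) = π - arccos x` absorbs the constants `∓2π`. The factor `-2` matches
the squared conjugate of `shiftDir` that rotates the ends of an inner arc. -/
lemma g_eq {E h μ I : ℝ} (hμ : 0 < μ) (hI : I ^ 2 < E + h + μ) :
    g E h μ I = -2 * shiftArg μ (E + h + μ) I := by
  have hs := Real.sqrt_pos.mpr (sub_pos.mpr hI)
  have h4 : √(4 * (E + h) * I ^ 2 + μ ^ 2) = ‖shiftDir μ (E + h + μ) I‖ := by
    rw [norm_shiftDir hI]; congr 1; ring
  have h5 : (2 * I ^ 2 - μ) / √(4 * (E + h) * I ^ 2 + μ ^ 2) =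
      -((shiftDir μ (E + h + μ) I).re / ‖shiftDir μ (E + h + μ) I‖) := by
    rw [h4, shiftDir_re, ← neg_div]; congr 1; ring
  unfold g shiftArg
  split_ifs with h1 h2
  · rw [h5, Real.arccos_neg, Complex.arg_of_im_pos]
    · ring
    · rw [shiftDir_im]; positivity
  · subst h2
    rw [shiftDir]
    simp [Complex.arg_ofReal_of_nonneg hμ.le]
  · rw [h5, Real.arccos_neg, Complex.arg_of_im_neg]
    · ring
    · rw [shiftDir_im]
      have : I < 0 := lt_of_le_of_ne (not_lt.mp h1) h2
      nlinarith

lemma hasDerivAt_sqrt_sub_sq (hB : I ^ 2 < B) :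
    HasDerivAt (fun I => √(B - I ^ 2)) (-I / √(B - I ^ 2)) I := by
  have h := ((hasDerivAt_pow 2 I).const_sub B).sqrt (sub_pos.mpr hB).ne'
  convert h using 1
  have := Real.sqrt_pos.mpr (sub_pos.mpr hB)
  field_simp
  norm_num
  ring

/-- The argument is the imaginary part of the logarithm, so its derivative is the imaginary part of
the logarithmic derivative of `shiftDir`. -/
lemma hasDerivAt_shiftArg (hA : 0 < A) (hB : I ^ 2 < B) :
    HasDerivAt (shiftArg A B) ((2 * A * B + 4 * (B - A) * I ^ 2) /
      (√(B - I ^ 2) * (A ^ 2 + 4 * (B - A) * I ^ 2))) I := by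
  have hs := Real.sqrt_pos.mpr (sub_pos.mpr hB)
  have hs2 := Real.sq_sqrt (sub_pos.mpr hB).le
  have h1 : HasDerivAt (fun I : ℝ => A - 2 * I ^ 2) (-4 * I) I := by
    refine (((hasDerivAt_pow 2 I).const_mul 2).const_sub A).congr_deriv ?_
    norm_num
    ring
  have h2 : HasDerivAt (fun I : ℝ => 2 * I * √(B - I ^ 2))
      (2 * √(B - I ^ 2) + 2 * I * (-I / √(B - I ^ 2))) I := by
    refine (((hasDerivAt_id I).const_mul 2).mul (hasDerivAt_sqrt_sub_sq hB)).congr_deriv ?_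
    simp
  have h3 := (h1.ofReal_comp.add (h2.ofReal_comp.mul_const Complex.I)).clog_real
    (shiftDir_mem_slitPlane hA hB)
  have h4 := Complex.imCLM.hasFDerivAt.comp_hasDerivAt I h3
  have hn := shift_modulus_pos hA hB
  have h5 : shiftArg A B = fun I => (Complex.log (shiftDir A B I)).im :=
    funext fun I => (Complex.log_im _).symm
  rw [h5]
  refine HasDerivAt.congr_deriv h4 ?_
  change (_ / shiftDir A B I).im = _
  rw [Complex.div_im, normSq_shiftDir hB, shiftDir_re, shiftDir_im]
  simp only [Complex.add_re, Complex.add_im, Complex.re_ofReal_mul, Complex.im_ofReal_mul,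
    Complex.ofReal_re, Complex.ofReal_im, Complex.I_re, Complex.I_im]
  generalize √(B - I ^ 2) = s at *
  -- Eliminating `B` in favour of `s = √(B - I²)` leaves an identity of rational functions.
  have hBs : B = s ^ 2 + I ^ 2 := by linarith
  subst hBs
  field_simp
  ring

lemma analyticAt_shiftArg (hA : 0 < A) (hB : I ^ 2 < B) : AnalyticAt ℝ (shiftArg A B) I := by
  have h2 : AnalyticAt ℝ (fun I => √(B - I ^ 2)) I := by
    have : AnalyticAt ℝ Real.sqrt (B - I ^ 2) :=
      (Real.contDiffAt_sqrt (n := ⊤) (sub_pos.mpr hB).ne').analyticAt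
    exact this.comp (f := fun I => B - I ^ 2) (by fun_prop)
  have h3 : AnalyticAt ℝ (shiftDir A B) I := by
    have hc : ∀ x : ℝ, AnalyticAt ℝ (fun r : ℝ => (r : ℂ)) x :=
      fun x => Complex.ofRealCLM.analyticAt x
    refine AnalyticAt.add ?_ (AnalyticAt.mul ?_ analyticAt_const)
    · exact (hc _).comp (f := fun I => A - 2 * I ^ 2) (by fun_prop)
    · exact (hc _).comp (f := fun I => 2 * I * √(B - I ^ 2)) (by fun_prop)
  have h4 := ((analyticAt_clog (shiftDir_mem_slitPlane hA hB)).restrictScalars (𝕜 := ℝ)).comp h3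
  have h5 : shiftArg A B = Complex.imCLM ∘ Complex.log ∘ shiftDir A B :=
    funext fun I => (Complex.log_im _).symm
  rw [h5]
  exact (Complex.imCLM.analyticAt _).comp h4

lemma sq_lt_of_mem {E ω I : ℝ} (hI : I ∈ Ioo (-Ic E ω) (Ic E ω)) : I ^ 2 < E - ω ^ 2 / 2 := by
  rw [mem_Ioo_Ic_iff] at hI; linarith

/-! ### The critical points of the shift -/

open Polynomial in
-- The hypothesis is the nonvanishing of the coefficient of `x⁵`, which makes the degree exactly
-- `5`.
lemma exists_quintic (a₀ a₁ a₂ b₀ b₁ b₂ M c : ℝ) (h : -a₂ ^ 2 + 4 * b₂ ^ 2 ≠ 0) :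
    ∃ P : ℝ[X], P.natDegree = 5 ∧ ∀ x, P.eval x =
      (a₀ + a₁ * x + a₂ * x ^ 2) ^ 2 * (M - x)
        - 4 * (b₀ + b₁ * x + b₂ * x ^ 2) ^ 2 * (c - x) := by
  refine ⟨C (-a₂ ^ 2 + 4 * b₂ ^ 2) * X ^ 5
    + C (M * a₂ ^ 2 - 2 * a₁ * a₂ - 4 * (c * b₂ ^ 2 - 2 * b₁ * b₂)) * X ^ 4
    + C (M * (2 * a₁ * a₂) - (a₁ ^ 2 + 2 * a₀ * a₂)
      - 4 * (c * (2 * b₁ * b₂) - (b₁ ^ 2 + 2 * b₀ * b₂))) * X ^ 3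
    + C (M * (a₁ ^ 2 + 2 * a₀ * a₂) - 2 * a₀ * a₁
      - 4 * (c * (b₁ ^ 2 + 2 * b₀ * b₂) - 2 * b₀ * b₁)) * X ^ 2
    + C (M * (2 * a₀ * a₁) - a₀ ^ 2 - 4 * (c * (2 * b₀ * b₁) - b₀ ^ 2)) * X
    + C (M * a₀ ^ 2 - 4 * (c * b₀ ^ 2)), ?_, fun x => ?_⟩
  · compute_degree!
  · simp only [eval_add, eval_mul, eval_C, eval_pow, eval_X]
    ring

lemma encard_setOf_eval_sq_le (P : Polynomial ℝ) (hP : P ≠ 0) :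
    {I : ℝ | P.eval (I ^ 2) = 0}.encard ≤ 2 * P.natDegree := by
  classical
  have hsub : {I : ℝ | P.eval (I ^ 2) = 0} ⊆
      (P.roots.toFinset.biUnion fun r => {√r, -√r} : Finset ℝ) := by
    intro I hI
    simp only [Finset.coe_biUnion, mem_iUnion]
    refine ⟨I ^ 2, ?_, ?_⟩
    · simpa [hP] using hI
    · rw [Real.sqrt_sq_eq_abs]
      rcases abs_choice I with h | h <;> simp [h]
  refine (encard_le_encard hsub).trans ?_
  rw [encard_coe_eq_coe_finsetCard]
  have h1 : (P.roots.toFinset.biUnion fun r => ({√r, -√r} : Finset ℝ)).card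
      ≤ P.roots.toFinset.card * 2 := Finset.card_biUnion_le_card_mul _ _ _
        fun r _ => Finset.card_le_two
  have h2 : P.roots.toFinset.card ≤ P.natDegree :=
    (Multiset.toFinset_card_le _).trans (Polynomial.card_roots' P)
  exact_mod_cast (by omega : _ ≤ 2 * P.natDegree)

/-! ### Derivatives, analyticity and critical points of the two shifts. -/

lemma sq_lt_of_VE_lt_VI {E h μ ω I : ℝ} (hV : ∀ z : ℂ, ‖z‖ = 1 → VE E ω z < VI E h μ z)
    (hI : I ^ 2 < E - ω ^ 2 / 2) : I ^ 2 < E + h + μ := by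
  have h1 := hV 1 (by simp)
  rw [VE_of_norm_one E ω (by simp), VI_of_norm_one E h μ (by simp)] at h1
  linarith

lemma hasDerivAt_f {E ω I : ℝ} (hE : ω ^ 2 / 2 < E) (hI : I ^ 2 < E - ω ^ 2 / 2) :
    HasDerivAt (f E ω) ((2 * E * (E - ω ^ 2 / 2) - 2 * ω ^ 2 * I ^ 2) /
      (√(E - ω ^ 2 / 2 - I ^ 2) * (E ^ 2 - 2 * ω ^ 2 * I ^ 2))) I := by
  have hE0 : 0 < E := by nlinarith [sq_nonneg ω]
  have hev : f E ω =ᶠ[𝓝 I] shiftArg E (E - ω ^ 2 / 2) := by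
    have : ∀ᶠ J in 𝓝 I, J ^ 2 < E - ω ^ 2 / 2 :=
      (continuous_pow 2).continuousAt.eventually_lt_const hI
    filter_upwards [this] with J hJ using f_eq hE hJ
  refine ((hasDerivAt_shiftArg hE0 hI).congr_deriv ?_).congr_of_eventuallyEq hev
  congr 1 <;> ring

lemma hasDerivAt_g {E h μ I : ℝ} (hμ : 0 < μ) (hI : I ^ 2 < E + h + μ) :
    HasDerivAt (g E h μ) (-2 * (2 * μ * (E + h + μ) + 4 * (E + h) * I ^ 2) /
      (√(E + h + μ - I ^ 2) * (μ ^ 2 + 4 * (E + h) * I ^ 2))) I := by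
  have hev : g E h μ =ᶠ[𝓝 I] fun J => -2 * shiftArg μ (E + h + μ) J := by
    have : ∀ᶠ J in 𝓝 I, J ^ 2 < E + h + μ :=
      (continuous_pow 2).continuousAt.eventually_lt_const hI
    filter_upwards [this] with J hJ using g_eq hμ hJ
  refine (((hasDerivAt_shiftArg hμ hI).const_mul (-2)).congr_deriv ?_).congr_of_eventuallyEq hev
  rw [← mul_div_assoc]
  congr 1 <;> ring

lemma analyticAt_f {E ω I : ℝ} (hE : ω ^ 2 / 2 < E) (hI : I ^ 2 < E - ω ^ 2 / 2) :
    AnalyticAt ℝ (f E ω) I := by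
  have hE0 : 0 < E := by nlinarith [sq_nonneg ω]
  refine (analyticAt_shiftArg hE0 hI).congr ?_
  have : ∀ᶠ J in 𝓝 I, J ^ 2 < E - ω ^ 2 / 2 :=
    (continuous_pow 2).continuousAt.eventually_lt_const hI
  filter_upwards [this] with J hJ using (f_eq hE hJ).symm

lemma analyticAt_g {E h μ I : ℝ} (hμ : 0 < μ) (hI : I ^ 2 < E + h + μ) :
    AnalyticAt ℝ (g E h μ) I := by
  refine ((analyticAt_const (v := (-2 : ℝ))).mul (analyticAt_shiftArg hμ hI)).congr ?_
  have : ∀ᶠ J in 𝓝 I, J ^ 2 < E + h + μ :=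
    (continuous_pow 2).continuousAt.eventually_lt_const hI
  filter_upwards [this] with J hJ using (g_eq hμ hJ).symm

lemma exists_critical_polynomial {E h μ ω : ℝ} (hμ : 0 < μ) (hω : 0 < ω) (hEh : 0 < E + h)
    (hE : ω ^ 2 / 2 < E) (hV : ∀ z : ℂ, ‖z‖ = 1 → VE E ω z < VI E h μ z) :
    ∃ P : Polynomial ℝ, P.natDegree = 5 ∧
      ∀ I ∈ Ioo (-Ic E ω) (Ic E ω), deriv (thetaBar E h μ ω) I = 0 → P.eval (I ^ 2) = 0 := by
  set c := E - ω ^ 2 / 2 with hc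
  set M := E + h + μ with hM
  set K := E + h with hK
  -- With `x = I²`, the coefficients are those of `(E c - ω² x) (μ² + 4 K x)` and `(μ M + 2 K x) (E²
  -- - 2 ω² x)`. Their leading coefficients coincide, so the two contributions to `x⁵` have ratio
  -- `-1 : 4` and cannot cancel.
  obtain ⟨P, hP5, hP⟩ := exists_quintic (E * c * μ ^ 2) (4 * K * E * c - ω ^ 2 * μ ^ 2)
    (-4 * K * ω ^ 2) (μ * M * E ^ 2) (2 * K * E ^ 2 - 2 * ω ^ 2 * μ * M) (-4 * K * ω ^ 2) M c
    (by rw [show -(-4 * K * ω ^ 2) ^ 2 + 4 * (-4 * K * ω ^ 2) ^ 2 = 48 * (K * ω ^ 2) ^ 2 by ring]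
        positivity)
  refine ⟨P, hP5, fun I hI hd => ?_⟩
  have hI1 := sq_lt_of_mem hI
  have hI2 := sq_lt_of_VE_lt_VI hV hI1
  have hE0 : 0 < E := by nlinarith
  have hN1 := shift_modulus_pos hE0 hI1
  have hN2 := shift_modulus_pos hμ hI2
  rw [show E ^ 2 + 4 * (E - ω ^ 2 / 2 - E) * I ^ 2 = E ^ 2 - 2 * ω ^ 2 * I ^ 2 by ring] at hN1
  rw [show μ ^ 2 + 4 * (E + h + μ - μ) * I ^ 2 = μ ^ 2 + 4 * (E + h) * I ^ 2 by ring] at hN2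
  have hθ := ((hasDerivAt_f hE hI1).add (hasDerivAt_g hμ hI2)).deriv
  change deriv (thetaBar E h μ ω) I = _ at hθ
  rw [hd] at hθ
  have hs := Real.sqrt_pos.mpr (sub_pos.mpr hI1)
  have hs2 := Real.sq_sqrt (sub_pos.mpr hI1).le
  have hσ := Real.sqrt_pos.mpr (sub_pos.mpr hI2)
  have hσ2 := Real.sq_sqrt (sub_pos.mpr hI2).le
  rw [← hK, ← hc] at *
  rw [← hM] at *
  generalize √(c - I ^ 2) = s at *
  generalize √(M - I ^ 2) = σ at *
  -- The critical equation with denominators cleared. Multiplying it by the sum of its two sides,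
  -- which amounts to squaring, removes the roots `s` and `σ`.
  have key : (E * c - ω ^ 2 * I ^ 2) * (μ ^ 2 + 4 * K * I ^ 2) * σ =
      2 * (μ * M + 2 * K * I ^ 2) * (E ^ 2 - 2 * ω ^ 2 * I ^ 2) * s := by
    rw [div_add_div _ _ (by positivity) (by positivity), eq_comm, div_eq_zero_iff] at hθ
    rcases hθ with hθ | hθ
    · linear_combination hθ / 2
    · exact absurd hθ (by positivity)
  rw [hP, ← hσ2, ← hs2]
  linear_combination ((E * c - ω ^ 2 * I ^ 2) * (μ ^ 2 + 4 * K * I ^ 2) * σ +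
      2 * (μ * M + 2 * K * I ^ 2) * (E ^ 2 - 2 * ω ^ 2 * I ^ 2) * s) * key

end

section

/-! ### Outer arcs -/

/-- A function with vanishing derivative on a compact interval is constant. -/
lemma eq_of_hasDerivWithinAt_zero {F : ℝ → ℂ} {T : ℝ}
    (h : ∀ s ∈ Icc 0 T, HasDerivWithinAt F 0 (Icc 0 T) s) : ∀ s ∈ Icc 0 T, F s = F 0 :=
  constant_of_has_deriv_right_zero (fun s hs => (h s hs).continuousWithinAt)
    fun s hs => (h s (Ico_subset_Icc_self hs)).mono_of_mem_nhdsWithin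
      (Icc_mem_nhdsGE_of_mem hs)

lemma hasDerivAt_cos_mul (ω t : ℝ) :
    HasDerivAt (fun t : ℝ => (Real.cos (ω * t) : ℂ)) (-(ω * Real.sin (ω * t) : ℂ)) t := by
  have h := (((hasDerivAt_id t).const_mul ω).cos).ofReal_comp
  refine HasDerivAt.congr_deriv h ?_
  push_cast; simp; ring

lemma hasDerivAt_sin_mul (ω t : ℝ) :
    HasDerivAt (fun t : ℝ => (Real.sin (ω * t) : ℂ)) (ω * Real.cos (ω * t) : ℂ) t := by
  have h := (((hasDerivAt_id t).const_mul ω).sin).ofReal_comp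
  refine HasDerivAt.congr_deriv h ?_
  push_cast; simp; ring

lemma cos_sq_add_sin_sq_cast (x : ℝ) : (Real.cos x : ℂ) ^ 2 + (Real.sin x : ℂ) ^ 2 = 1 := by
  exact_mod_cast Real.cos_sq_add_sin_sq x

/-- Rotating the pair `(ω z, v)` back by the angle `ω t` gives two constants of motion. This proves
the explicit formula without an appeal to uniqueness for differential equations. -/
lemma outer_solution {E ω T : ℝ} {z v : ℝ → ℂ} (hω : 0 < ω)
    (h : SolvesOn (VE E ω) (Icc 0 T) z v) {t : ℝ} (ht : t ∈ Icc 0 T) :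
    z t = Real.cos (ω * t) * z 0 + Real.sin (ω * t) / ω * v 0 ∧
    v t = Real.cos (ω * t) * v 0 - ω * Real.sin (ω * t) * z 0 := by
  have hv : ∀ s ∈ Icc 0 T, HasDerivWithinAt v (-(ω ^ 2 : ℂ) * z s) (Icc 0 T) s := fun s hs => by
    rw [← gradient_VE]; exact h.newton s hs
  have h1 := eq_of_hasDerivWithinAt_zero (T := T)
    (F := fun s => (ω : ℂ) * (z s * Real.cos (ω * s)) - v s * Real.sin (ω * s)) (fun s hs => by
      refine ((((h.velocity s hs).mul (hasDerivAt_cos_mul ω s).hasDerivWithinAt).const_mul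
        (ω : ℂ)).sub ((hv s hs).mul (hasDerivAt_sin_mul ω s).hasDerivWithinAt)).congr_deriv ?_
      ring) t ht
  have h2 := eq_of_hasDerivWithinAt_zero (T := T)
    (F := fun s => (ω : ℂ) * (z s * Real.sin (ω * s)) + v s * Real.cos (ω * s)) (fun s hs => by
      refine ((((h.velocity s hs).mul (hasDerivAt_sin_mul ω s).hasDerivWithinAt).const_mul
        (ω : ℂ)).add ((hv s hs).mul (hasDerivAt_cos_mul ω s).hasDerivWithinAt)).congr_deriv ?_
      ring) t ht
  simp only [mul_zero, Real.cos_zero, Real.sin_zero, Complex.ofReal_one, Complex.ofReal_zero,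
    mul_one, sub_zero, zero_add] at h1 h2
  have h3 := cos_sq_add_sin_sq_cast (ω * t)
  have hω' : (ω : ℂ) ≠ 0 := by exact_mod_cast hω.ne'
  constructor
  · field_simp
    linear_combination Real.cos (ω * t) * h1 + Real.sin (ω * t) * h2 - ω * z t * h3
  · linear_combination -Real.sin (ω * t) * h1 + Real.cos (ω * t) * h2 - v t * h3

/-- The direction whose argument is the eccentric length of the outer arcs with initial radial
velocity `a`. -/
def outerPhase (E ω a : ℝ) : ℂ := (ω ^ 2 - E : ℝ) + (ω * a : ℝ) * Complex.I

/-- The duration of the outer arcs with initial radial velocity `a`. -/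
def outerTime (E ω a : ℝ) : ℝ := Complex.arg (outerPhase E ω a) / ω

variable {E ω a L : ℝ}

lemma outerPhase_re : (outerPhase E ω a).re = ω ^ 2 - E := by
  simp [outerPhase, -Complex.ofReal_pow]

lemma outerPhase_im : (outerPhase E ω a).im = ω * a := by
  simp [outerPhase, -Complex.ofReal_pow]

lemma norm_outerPhase_pos (hω : 0 < ω) (ha : 0 < a) : 0 < ‖outerPhase E ω a‖ := by
  rw [norm_pos_iff]
  intro h
  have := congrArg Complex.im h
  rw [outerPhase_im] at this
  exact (mul_pos hω ha).ne' this

lemma norm_mul_cos_outerPhase :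
    ‖outerPhase E ω a‖ * Real.cos (Complex.arg (outerPhase E ω a)) = ω ^ 2 - E := by
  rw [Complex.norm_mul_cos_arg, outerPhase_re]

lemma norm_mul_sin_outerPhase :
    ‖outerPhase E ω a‖ * Real.sin (Complex.arg (outerPhase E ω a)) = ω * a := by
  rw [Complex.norm_mul_sin_arg, outerPhase_im]

lemma arg_outerPhase_mem (hω : 0 < ω) (ha : 0 < a) :
    Complex.arg (outerPhase E ω a) ∈ Ioo 0 Real.pi := by
  constructor
  · refine lt_of_le_of_ne (Complex.arg_nonneg_iff.mpr ?_) fun h => ?_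
    · rw [outerPhase_im]; positivity
    · have := (Complex.arg_eq_zero_iff.mp h.symm).2
      rw [outerPhase_im] at this
      exact (mul_pos hω ha).ne' this
  · refine Complex.arg_lt_pi_iff.mpr (Or.inr ?_)
    rw [outerPhase_im]
    exact (mul_pos hω ha).ne'

/-- This factorization controls the whole outer arc: for `φ` between `0` and the argument of
`outerPhase` both sines are positive, and at that argument the second one vanishes. -/
lemma norm_sq_outer_point (hω : 0 < ω) (hE : a ^ 2 + L ^ 2 = 2 * E - ω ^ 2) {p : ℂ}
    (hp : ‖p‖ = 1) (φ : ℝ) :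
    ‖Real.cos φ * p + Real.sin φ / ω * ((a + L * Complex.I) * p)‖ ^ 2 = 1 +
      2 * ‖outerPhase E ω a‖ / ω ^ 2 * Real.sin φ *
        Real.sin (Complex.arg (outerPhase E ω a) - φ) := by
  have h1 : (Real.cos φ * p + Real.sin φ / ω * ((a + L * Complex.I) * p) : ℂ) =
      ((Real.cos φ + Real.sin φ / ω * a : ℝ) + (Real.sin φ / ω * L : ℝ) * Complex.I) * p := by
    push_cast; ring
  have h2 := norm_mul_cos_outerPhase (E := E) (ω := ω) (a := a)
  have h3 := norm_mul_sin_outerPhase (E := E) (ω := ω) (a := a)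
  have h4 := Real.cos_sq_add_sin_sq φ
  rw [h1, norm_mul, hp, mul_one, Complex.sq_norm, Complex.normSq_add_mul_I, Real.sin_sub]
  field_simp
  linear_combination ω ^ 2 * h4 + Real.sin φ ^ 2 * hE -
    2 * Real.sin φ * Real.cos φ * h3 + 2 * Real.sin φ ^ 2 * h2

/-- The rotation factor depends only on the initial components; for `L = √2 I` its numerator is
`shiftDir`, by `outer_factor_eq`. -/
lemma outer_end_point (hω : 0 < ω) (ha : 0 < a) (hE : a ^ 2 + L ^ 2 = 2 * E - ω ^ 2) (p : ℂ) :
    Real.cos (Complex.arg (outerPhase E ω a)) * p +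
      Real.sin (Complex.arg (outerPhase E ω a)) / ω * ((a + L * Complex.I) * p) =
    p * (((E - L ^ 2 : ℝ) + (L * a : ℝ) * Complex.I) / ‖outerPhase E ω a‖) := by
  have h2 := congrArg (Complex.ofReal) (norm_mul_cos_outerPhase (E := E) (ω := ω) (a := a))
  have h3 := congrArg (Complex.ofReal) (norm_mul_sin_outerPhase (E := E) (ω := ω) (a := a))
  have h4 := congrArg (Complex.ofReal) hE
  have hN : (‖outerPhase E ω a‖ : ℂ) ≠ 0 := by
    exact_mod_cast (norm_outerPhase_pos hω ha).ne'
  have hω' : (ω : ℂ) ≠ 0 := by exact_mod_cast hω.ne'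
  simp only [Complex.ofReal_mul, Complex.ofReal_add, Complex.ofReal_sub,
    Complex.ofReal_pow, Complex.ofReal_ofNat] at h2 h3 h4 ⊢
  field_simp
  linear_combination ω * p * h2 + p * (a + L * Complex.I) * h3 + ω * p * h4

lemma outer_end_velocity (hω : 0 < ω) (ha : 0 < a) (hE : a ^ 2 + L ^ 2 = 2 * E - ω ^ 2) (p : ℂ) :
    Real.cos (Complex.arg (outerPhase E ω a)) * ((a + L * Complex.I) * p) -
      ω * Real.sin (Complex.arg (outerPhase E ω a)) * p =
    (-a + L * Complex.I) *
      (p * (((E - L ^ 2 : ℝ) + (L * a : ℝ) * Complex.I) / ‖outerPhase E ω a‖)) := by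
  have h2 := congrArg (Complex.ofReal) (norm_mul_cos_outerPhase (E := E) (ω := ω) (a := a))
  have h3 := congrArg (Complex.ofReal) (norm_mul_sin_outerPhase (E := E) (ω := ω) (a := a))
  have h4 := congrArg (Complex.ofReal) hE
  have hN : (‖outerPhase E ω a‖ : ℂ) ≠ 0 := by
    exact_mod_cast (norm_outerPhase_pos hω ha).ne'
  simp only [Complex.ofReal_mul, Complex.ofReal_add, Complex.ofReal_sub,
    Complex.ofReal_pow, Complex.ofReal_ofNat] at h2 h3 h4 ⊢
  field_simp
  linear_combination p * (a + L * Complex.I) * h2 - ω * p * h3 + p * L * Complex.I * h4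
    - p * L ^ 2 * a * Complex.I_sq

/-- The outer arcs are determined by their initial data. -/
lemma IsOuterArc.end_data {T : ℝ} {z v : ℝ → ℂ} (h : IsOuterArc E ω T z v) (hω : 0 < ω)
    (ha : 0 < a) (hE : a ^ 2 + L ^ 2 = 2 * E - ω ^ 2) (hv : v 0 = (a + L * Complex.I) * z 0) :
    T = outerTime E ω a ∧
    z T = z 0 * (((E - L ^ 2 : ℝ) + (L * a : ℝ) * Complex.I) / ‖outerPhase E ω a‖) ∧
    v T = (-a + L * Complex.I) * z T := by
  have hN : 0 < ‖outerPhase E ω a‖ := norm_outerPhase_pos hω ha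
  obtain ⟨hφ0, hφπ⟩ := arg_outerPhase_mem (E := E) hω ha
  have hz : ∀ t ∈ Icc 0 T, ‖z t‖ ^ 2 = 1 + 2 * ‖outerPhase E ω a‖ / ω ^ 2 * Real.sin (ω * t) *
        Real.sin (Complex.arg (outerPhase E ω a) - ω * t) := fun t ht => by
    rw [(outer_solution hω h.solves ht).1, hv]
    exact norm_sq_outer_point hω hE h.start (ω * t)
  have hT := h.pos
  -- A longer arc would meet the circle at an interior time.
  have hle : ω * T ≤ Complex.arg (outerPhase E ω a) := by
    by_contra! hlt
    have ht : Complex.arg (outerPhase E ω a) / ω ∈ Ioo 0 T :=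
      ⟨by positivity, by rw [div_lt_iff₀ hω]; linarith⟩
    have h1 := hz _ (Ioo_subset_Icc_self ht)
    rw [mul_div_cancel₀ _ hω.ne', sub_self, Real.sin_zero, mul_zero, add_zero] at h1
    have h2 := h.outside _ ht
    nlinarith
  -- A shorter arc would end strictly outside the disk, both sines being positive.
  have hφ : ω * T = Complex.arg (outerPhase E ω a) := by
    by_contra hne
    have hlt := lt_of_le_of_ne hle hne
    have h1 := hz T (right_mem_Icc.mpr hT.le)
    rw [h.finish] at h1
    have h2 : 0 < Real.sin (ω * T) := Real.sin_pos_of_pos_of_lt_pi (by positivity) (by linarith)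
    have h3 : 0 < Real.sin (Complex.arg (outerPhase E ω a) - ω * T) :=
      Real.sin_pos_of_pos_of_lt_pi (by linarith) (by nlinarith)
    have : 0 < 2 * ‖outerPhase E ω a‖ / ω ^ 2 * Real.sin (ω * T) *
        Real.sin (Complex.arg (outerPhase E ω a) - ω * T) := by positivity
    linarith
  obtain ⟨h1, h2⟩ := outer_solution hω h.solves (right_mem_Icc.mpr hT.le)
  rw [hφ, hv] at h1 h2
  have h1' := h1.trans (outer_end_point hω ha hE (z 0))
  refine ⟨by rw [outerTime, ← hφ]; field_simp, h1', ?_⟩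
  rw [h2, h1']
  exact outer_end_velocity hω ha hE (z 0)

lemma exists_outerArc (hω : 0 < ω) (ha : 0 < a) (hE : a ^ 2 + L ^ 2 = 2 * E - ω ^ 2) {p : ℂ}
    (hp : ‖p‖ = 1) :
    ∃ T z v, IsOuterArc E ω T z v ∧ z 0 = p ∧ v 0 = (a + L * Complex.I) * p := by
  have hN : 0 < ‖outerPhase E ω a‖ := norm_outerPhase_pos hω ha
  obtain ⟨hφ0, hφπ⟩ := arg_outerPhase_mem (E := E) hω ha
  have hω' : (ω : ℂ) ≠ 0 := by exact_mod_cast hω.ne'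
  set z : ℝ → ℂ := fun t => Real.cos (ω * t) * p +
    Real.sin (ω * t) / ω * ((a + L * Complex.I) * p) with hz
  set v : ℝ → ℂ := fun t => Real.cos (ω * t) * ((a + L * Complex.I) * p) -
    ω * Real.sin (ω * t) * p with hv
  have hz0 : z 0 = p := by simp [hz]
  have hv0 : v 0 = (a + L * Complex.I) * p := by simp [hv]
  have hnorm : ∀ t, ‖z t‖ ^ 2 = 1 + 2 * ‖outerPhase E ω a‖ / ω ^ 2 * Real.sin (ω * t) *
        Real.sin (Complex.arg (outerPhase E ω a) - ω * t) := fun t =>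
    norm_sq_outer_point hω hE hp (ω * t)
  have hT : ω * outerTime E ω a = Complex.arg (outerPhase E ω a) := by
    rw [outerTime]; field_simp
  have hT0 : 0 < outerTime E ω a := by rw [outerTime]; positivity
  refine ⟨outerTime E ω a, z, v, ⟨hT0, by rw [hz0, hp], ?_, ?_, ⟨?_, ?_, ?_⟩⟩, hz0, hv0⟩
  · have h := hnorm (outerTime E ω a)
    rw [hT, sub_self, Real.sin_zero, mul_zero, add_zero] at h
    exact (pow_eq_one_iff_of_nonneg (norm_nonneg _) two_ne_zero).mp h
  · intro s hs
    have h := hnorm s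
    have hs1 : 0 < ω * s := mul_pos hω hs.1
    have hs2 : ω * s < Complex.arg (outerPhase E ω a) := by
      rw [← hT]; exact mul_lt_mul_of_pos_left hs.2 hω
    have h2 : 0 < Real.sin (ω * s) := Real.sin_pos_of_pos_of_lt_pi hs1 (by linarith)
    have h3 : 0 < Real.sin (Complex.arg (outerPhase E ω a) - ω * s) :=
      Real.sin_pos_of_pos_of_lt_pi (by linarith) (by linarith)
    have : 0 < 2 * ‖outerPhase E ω a‖ / ω ^ 2 * Real.sin (ω * s) *
        Real.sin (Complex.arg (outerPhase E ω a) - ω * s) := by positivity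
    nlinarith [norm_nonneg (z s)]
  · intro s _
    refine (((hasDerivAt_cos_mul ω s).mul_const p).add
      (((hasDerivAt_sin_mul ω s).div_const (ω : ℂ)).mul_const _)).congr_deriv ?_
      |>.hasDerivWithinAt
    simp only [hv]
    field_simp
    ring
  · intro s _
    refine (((hasDerivAt_cos_mul ω s).mul_const _).sub
      (((hasDerivAt_sin_mul ω s).const_mul (ω : ℂ)).mul_const p)).congr_deriv ?_
      |>.hasDerivWithinAt
    rw [gradient_VE]
    simp only [hz]
    field_simp
    ring
  · intro s _
    have h1 : z s = ((Real.cos (ω * s) + Real.sin (ω * s) / ω * a : ℝ) +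
        (Real.sin (ω * s) / ω * L : ℝ) * Complex.I) * p := by
      simp only [hz]; push_cast; ring
    have h2 : v s = ((Real.cos (ω * s) * a - ω * Real.sin (ω * s) : ℝ) +
        (Real.cos (ω * s) * L : ℝ) * Complex.I) * p := by
      simp only [hv]; push_cast; ring
    have h4 := Real.cos_sq_add_sin_sq (ω * s)
    rw [VE, h1, h2, norm_mul, norm_mul, hp, mul_one, mul_one, Complex.sq_norm, Complex.sq_norm,
      Complex.normSq_add_mul_I, Complex.normSq_add_mul_I]
    field_simp
    linear_combination (Real.cos (ω * s) ^ 2 + Real.sin (ω * s) ^ 2) * hE +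
      (2 * E) * h4

/-! ### The momentum `conj z * v` and the Jacobi length of outer arcs. -/

lemma hasDerivWithinAt_conj_mul {z v : ℝ → ℂ} {z' v' : ℂ} {s : Set ℝ} {t : ℝ}
    (hz : HasDerivWithinAt z z' s t) (hv : HasDerivWithinAt v v' s t) :
    HasDerivWithinAt (fun t => conj (z t) * v t) (conj z' * v t + conj (z t) * v') s t :=
  (Complex.conjCLE.toContinuousLinearMap.hasFDerivAt.comp_hasDerivWithinAt t hz).mul hv

lemma hasDerivWithinAt_re {W : ℝ → ℂ} {W' : ℂ} {s : Set ℝ} {t : ℝ}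
    (hW : HasDerivWithinAt W W' s t) : HasDerivWithinAt (fun t => (W t).re) W'.re s t :=
  Complex.reCLM.hasFDerivAt.comp_hasDerivWithinAt t hW

/-- A virial identity: the real part of the momentum has derivative `|v|² - ω² |z|² = 4 V - 2 E`, so
the density `√2 V` has an elementary primitive. At the ends that real part is `a` and `-a`. -/
lemma IsOuterArc.jacobiLength_eq {T : ℝ} {z v : ℝ → ℂ} (h : IsOuterArc E ω T z v) (hω : 0 < ω)
    (ha : 0 < a) (hE : a ^ 2 + L ^ 2 = 2 * E - ω ^ 2) (hv : v 0 = (a + L * Complex.I) * z 0) :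
    jacobiLength (VE E ω) T z v = (E * outerTime E ω a - a) / √2 := by
  obtain ⟨hT, -, hvT⟩ := h.end_data hω ha hE hv
  have hT0 := h.pos
  have hder : ∀ t ∈ Icc 0 T, HasDerivWithinAt
      (fun t => √2 * (E * t / 2 + (conj (z t) * v t).re / 4)) (‖v t‖ * √(VE E ω (z t)))
      (Icc 0 T) t := fun t ht => by
    have h1 := hasDerivWithinAt_re
      (hasDerivWithinAt_conj_mul (h.solves.velocity t ht) (h.solves.newton t ht))
    have h2 : HasDerivWithinAt (fun t => E * t / 2) (E / 2) (Icc 0 T) t := by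
      simpa using (((hasDerivAt_id t).const_mul E).div_const 2).hasDerivWithinAt
    refine ((h2.add (h1.div_const 4)).const_mul √2).congr_deriv ?_
    have hen := h.solves.energy t ht
    rw [norm_mul_sqrt_of_energy hen, gradient_VE]
    congr 1
    have h3 : conj (v t) * v t + conj (z t) * (-(ω ^ 2 : ℂ) * z t) =
        ((‖v t‖ ^ 2 - ω ^ 2 * ‖z t‖ ^ 2 : ℝ) : ℂ) := by
      push_cast
      linear_combination Complex.conj_mul' (v t) - ω ^ 2 * Complex.conj_mul' (z t)
    rw [h3, Complex.ofReal_re]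
    unfold VE at hen ⊢
    linarith
  have hcont : ContinuousOn (fun t => ‖v t‖ * √(VE E ω (z t))) (Icc 0 T) := by
    have h1 : ContinuousOn z (Icc 0 T) := fun t ht =>
      (h.solves.velocity t ht).continuousWithinAt
    have h2 : ContinuousOn v (Icc 0 T) := fun t ht => (h.solves.newton t ht).continuousWithinAt
    unfold VE
    fun_prop
  rw [jacobiLength, intervalIntegral.integral_eq_sub_of_hasDerivAt_of_le hT0.le
    (fun t ht => (hder t ht).continuousWithinAt)
    (fun t ht => (hder t (Ioo_subset_Icc_self ht)).hasDerivAt (Icc_mem_nhds ht.1 ht.2))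
    (hcont.intervalIntegrable_of_Icc hT0.le), hvT, hv]
  have h5 : ∀ p c : ℂ, ‖p‖ = 1 → (conj p * (c * p)) = c := fun p c hp => by
    linear_combination -(eq_conj_mul_mul hp c)
  rw [h5 _ _ h.start, h5 _ _ h.finish, ← hT]
  simp
  have h6 : √2 ^ 2 = 2 := Real.sq_sqrt (by norm_num)
  field_simp
  rw [h6]
  ring

end

section

/-! ### The Keplerian hyperbolas -/

/-- The modulus of the direction that gives the inner shift. -/
def kepMod (K μ L : ℝ) : ℝ := √(2 * K * L ^ 2 + μ ^ 2)

/-- The Keplerian hyperbola of energy `K` and angular momentum `L`, with horizontal axis,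
parametrized by twice the eccentric anomaly. -/
def kepCurve (K μ L y : ℝ) : ℂ :=
  ((kepMod K μ L - μ * Real.cosh y : ℝ) + (√(2 * K) * L * Real.sinh y : ℝ) * Complex.I) /
    (2 * K : ℝ)

/-- The derivative of `kepCurve`. -/
def kepCurveDeriv (K μ L y : ℝ) : ℂ :=
  ((-(μ * Real.sinh y) : ℝ) + (√(2 * K) * L * Real.cosh y : ℝ) * Complex.I) / (2 * K : ℝ)

/-- The distance of `kepCurve` to the center. -/
def kepRadius (K μ L y : ℝ) : ℝ := (kepMod K μ L * Real.cosh y - μ) / (2 * K)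

/-- Kepler's equation: the time along `kepCurve`. -/
def kepTime (K μ L y : ℝ) : ℝ :=
  (kepMod K μ L * Real.sinh y - μ * y) / (2 * K * √(2 * K))

/-- The parameter at which `kepCurve` leaves the unit disk with radial velocity `b`. -/
def kepExit (K μ L b : ℝ) : ℝ := Real.arsinh (√(2 * K) * b / kepMod K μ L)

variable {K μ L b : ℝ}

lemma kepMod_pos (hK : 0 < K) (hμ : 0 < μ) : 0 < kepMod K μ L :=
  Real.sqrt_pos.mpr (by positivity)

lemma kepMod_sq (hK : 0 < K) : kepMod K μ L ^ 2 = 2 * K * L ^ 2 + μ ^ 2 :=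
  Real.sq_sqrt (by positivity)

lemma le_kepMod (hK : 0 < K) : μ ≤ kepMod K μ L :=
  Real.le_sqrt_of_sq_le (by nlinarith [mul_nonneg hK.le (sq_nonneg L)])

lemma sqrt_two_mul_sq (hK : 0 < K) : √(2 * K) ^ 2 = 2 * K := Real.sq_sqrt (by positivity)

lemma re_add_mul_I (a b : ℝ) : ((a : ℂ) + b * Complex.I).re = a := by simp

lemma im_add_mul_I (a b : ℝ) : ((a : ℂ) + b * Complex.I).im = b := by simp

lemma kepCurve_re (y : ℝ) :
    (kepCurve K μ L y).re = (kepMod K μ L - μ * Real.cosh y) / (2 * K) := by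
  rw [kepCurve, Complex.div_ofReal_re, re_add_mul_I]

lemma kepCurve_im (y : ℝ) :
    (kepCurve K μ L y).im = √(2 * K) * L * Real.sinh y / (2 * K) := by
  rw [kepCurve, Complex.div_ofReal_im, im_add_mul_I]

lemma kepCurveDeriv_re (y : ℝ) :
    (kepCurveDeriv K μ L y).re = -(μ * Real.sinh y) / (2 * K) := by
  rw [kepCurveDeriv, Complex.div_ofReal_re, re_add_mul_I]

lemma kepCurveDeriv_im (y : ℝ) :
    (kepCurveDeriv K μ L y).im = √(2 * K) * L * Real.cosh y / (2 * K) := by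
  rw [kepCurveDeriv, Complex.div_ofReal_im, im_add_mul_I]

lemma hasDerivAt_kepCurve (y : ℝ) :
    HasDerivAt (kepCurve K μ L) (kepCurveDeriv K μ L y) y := by
  have h1 := ((Real.hasDerivAt_cosh y).const_mul μ).const_sub (kepMod K μ L)
  have h2 := (Real.hasDerivAt_sinh y).const_mul (√(2 * K) * L)
  exact (h1.ofReal_comp.add (h2.ofReal_comp.mul_const Complex.I)).div_const _

lemma hasDerivAt_kepCurveDeriv (y : ℝ) :
    HasDerivAt (kepCurveDeriv K μ L)
      (((-(μ * Real.cosh y) : ℝ) + (√(2 * K) * L * Real.sinh y : ℝ) * Complex.I) /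
        (2 * K : ℝ)) y := by
  have h1 := ((Real.hasDerivAt_sinh y).const_mul μ).neg
  have h2 := (Real.hasDerivAt_cosh y).const_mul (√(2 * K) * L)
  exact (h1.ofReal_comp.add (h2.ofReal_comp.mul_const Complex.I)).div_const _

lemma hasDerivAt_kepRadius (y : ℝ) :
    HasDerivAt (kepRadius K μ L) (kepMod K μ L * Real.sinh y / (2 * K)) y :=
  (((Real.hasDerivAt_cosh y).const_mul (kepMod K μ L)).sub_const μ).div_const _

lemma hasDerivAt_kepTime (y : ℝ) :
    HasDerivAt (kepTime K μ L) (kepRadius K μ L y / √(2 * K)) y := by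
  refine ((((Real.hasDerivAt_sinh y).const_mul (kepMod K μ L)).sub
    ((hasDerivAt_id y).const_mul μ)).div_const _).congr_deriv ?_
  rw [kepRadius, mul_one, div_div]

lemma kepRadius_nonneg (hK : 0 < K) (hμ : 0 < μ) (y : ℝ) : 0 ≤ kepRadius K μ L y := by
  have h1 := Real.one_le_cosh y
  have h2 := le_kepMod (μ := μ) (L := L) hK
  refine div_nonneg ?_ (by positivity)
  nlinarith

/-- This includes `L = 0`, where `kepMod = μ` and the radius vanishes only at `y = 0`, the
collision. -/
lemma kepRadius_pos_of_ne_zero (hK : 0 < K) (hμ : 0 < μ) {y : ℝ} (hy : y ≠ 0) :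
    0 < kepRadius K μ L y := by
  have h1 := Real.one_lt_cosh.mpr hy
  have h2 := le_kepMod (μ := μ) (L := L) hK
  refine div_pos ?_ (by positivity)
  nlinarith

lemma kepRadius_pos (hK : 0 < K) (hμ : 0 < μ) (hL : L ≠ 0) (y : ℝ) :
    0 < kepRadius K μ L y := by
  have h1 := Real.one_le_cosh y
  have h2 : μ < kepMod K μ L := Real.lt_sqrt_of_sq_lt (by
    have : 0 < K * L ^ 2 := by positivity
    nlinarith)
  refine div_pos ?_ (by positivity)
  nlinarith

lemma norm_kepCurve (hK : 0 < K) (hμ : 0 < μ) (y : ℝ) :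
    ‖kepCurve K μ L y‖ = kepRadius K μ L y := by
  have h1 := Real.cosh_sq y
  have h2 := kepMod_sq (μ := μ) (L := L) hK
  have h3 := sqrt_two_mul_sq hK
  have h4 : ‖kepCurve K μ L y‖ ^ 2 = kepRadius K μ L y ^ 2 := by
    rw [kepCurve, kepRadius, norm_div, div_pow, div_pow, Complex.sq_norm,
      Complex.normSq_add_mul_I, Complex.norm_real, Real.norm_eq_abs, sq_abs]
    congr 1
    linear_combination (μ ^ 2 - kepMod K μ L ^ 2) * h1 - Real.sinh y ^ 2 * h2
      + L ^ 2 * Real.sinh y ^ 2 * h3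
  exact (pow_left_inj₀ (norm_nonneg _) (kepRadius_nonneg hK hμ y) two_ne_zero).mp h4

/-- Since `dt/dy = R / √(2K)` along the curve, the second factor is the momentum in physical time.
It exhibits `L` as the angular momentum and shows that the radial part is proportional to `sinh y`.
-/
lemma conj_kepCurve_mul_deriv (hK : 0 < K) (y : ℝ) :
    conj (kepCurve K μ L y) * kepCurveDeriv K μ L y = (kepRadius K μ L y / √(2 * K) : ℝ) *
      ((kepMod K μ L * Real.sinh y / √(2 * K) : ℝ) + L * Complex.I) := by
  have h1 := Real.cosh_sq y
  have h2 := kepMod_sq (μ := μ) (L := L) hK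
  have h3 := sqrt_two_mul_sq hK
  have hk0 : 0 < √(2 * K) := Real.sqrt_pos.mpr (by positivity)
  generalize hk : √(2 * K) = k at *
  rw [Complex.ext_iff, Complex.mul_re, Complex.mul_im, Complex.conj_re, Complex.conj_im,
    Complex.re_ofReal_mul, Complex.im_ofReal_mul, kepCurve_re, kepCurve_im, kepCurveDeriv_re,
    kepCurveDeriv_im, re_add_mul_I, im_add_mul_I, kepRadius, hk, ← h3]
  rw [← h3] at h2
  generalize kepMod K μ L = D at *
  constructor
  · field_simp
    linear_combination (-Real.cosh y * Real.sinh y) * h2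
  · field_simp
    linear_combination (-μ * L) * h1

/-- With `U` the curve and `R` the radius, this is `U'' R - U' R' = -(μ / 2K) U`: Newton's equation
after the time change `dt = R / √(2K) dy`, cleared of the powers of `R`. -/
lemma kepCurve_newton (hK : 0 < K) (y : ℝ) :
    ((-(μ * Real.cosh y) : ℝ) + (√(2 * K) * L * Real.sinh y : ℝ) * Complex.I) / (2 * K : ℝ) *
      kepRadius K μ L y - kepCurveDeriv K μ L y * (kepMod K μ L * Real.sinh y / (2 * K) : ℝ) =
    (-(μ / (2 * K)) : ℝ) * kepCurve K μ L y := by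
  have h1 := Real.cosh_sq y
  rw [Complex.ext_iff, Complex.sub_re, Complex.sub_im, Complex.re_mul_ofReal,
    Complex.re_mul_ofReal, Complex.im_mul_ofReal, Complex.im_mul_ofReal,
    Complex.re_ofReal_mul, Complex.im_ofReal_mul, Complex.div_ofReal_re, Complex.div_ofReal_im,
    re_add_mul_I, im_add_mul_I, kepCurve_re, kepCurve_im, kepCurveDeriv_re,
    kepCurveDeriv_im, kepRadius]
  constructor
  · field_simp
    linear_combination (-μ * kepMod K μ L) * h1
  · field_simp
    ring

lemma normSq_kepCurveDeriv (hK : 0 < K) (y : ℝ) :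
    ‖kepCurveDeriv K μ L y‖ ^ 2 = kepRadius K μ L y * (kepRadius K μ L y + μ / K) := by
  have h1 := Real.cosh_sq y
  have h2 := kepMod_sq (μ := μ) (L := L) hK
  have h3 := sqrt_two_mul_sq hK
  rw [kepCurveDeriv, kepRadius, norm_div, div_pow, Complex.sq_norm,
    Complex.normSq_add_mul_I, Complex.norm_real, Real.norm_eq_abs, sq_abs]
  field_simp
  linear_combination (-μ ^ 2) * h1 - Real.cosh y ^ 2 * h2 + L ^ 2 * Real.cosh y ^ 2 * h3

lemma kepCurve_neg (y : ℝ) : kepCurve K μ L (-y) = conj (kepCurve K μ L y) := by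
  rw [Complex.ext_iff, Complex.conj_re, Complex.conj_im, kepCurve_re, kepCurve_im, kepCurve_re,
    kepCurve_im, Real.cosh_neg, Real.sinh_neg]
  constructor <;> ring

lemma kepTime_neg (y : ℝ) : kepTime K μ L (-y) = -kepTime K μ L y := by
  rw [kepTime, kepTime, Real.sinh_neg]; ring

lemma sinh_kepExit : Real.sinh (kepExit K μ L b) = √(2 * K) * b / kepMod K μ L :=
  Real.sinh_arsinh _

lemma cosh_kepExit (hK : 0 < K) (hμ : 0 < μ) (hb : b ^ 2 + L ^ 2 = 2 * (K + μ)) :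
    Real.cosh (kepExit K μ L b) = (2 * K + μ) / kepMod K μ L := by
  have hD := kepMod_pos (L := L) hK hμ
  have h2 := kepMod_sq (μ := μ) (L := L) hK
  rw [kepExit, Real.cosh_arsinh, div_pow, mul_pow, sqrt_two_mul_sq hK]
  rw [show 1 + 2 * K * b ^ 2 / kepMod K μ L ^ 2 = ((2 * K + μ) / kepMod K μ L) ^ 2 by
    field_simp; linear_combination h2 + 2 * K * hb]
  exact Real.sqrt_sq (by positivity)

lemma kepExit_pos (hK : 0 < K) (hμ : 0 < μ) (hb : 0 < b) : 0 < kepExit K μ L b := by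
  have hD := kepMod_pos (L := L) hK hμ
  have : 0 < √(2 * K) := Real.sqrt_pos.mpr (by positivity)
  exact Real.arsinh_pos_iff.mpr (by positivity)

lemma kepRadius_kepExit (hK : 0 < K) (hμ : 0 < μ) (hb : b ^ 2 + L ^ 2 = 2 * (K + μ)) :
    kepRadius K μ L (kepExit K μ L b) = 1 := by
  have hD := kepMod_pos (L := L) hK hμ
  rw [kepRadius, cosh_kepExit hK hμ hb]
  field_simp
  ring

lemma kepCurve_kepExit (hK : 0 < K) (hμ : 0 < μ) (hb : b ^ 2 + L ^ 2 = 2 * (K + μ)) :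
    kepCurve K μ L (kepExit K μ L b) =
      -(((μ - L ^ 2 : ℝ) - (L * b : ℝ) * Complex.I) / kepMod K μ L) := by
  have hD := kepMod_pos (L := L) hK hμ
  have h2 := kepMod_sq (μ := μ) (L := L) hK
  have h3 := sqrt_two_mul_sq hK
  have h4 : kepMod K μ L - μ * ((2 * K + μ) / kepMod K μ L) =
      2 * K * (L ^ 2 - μ) / kepMod K μ L := by
    field_simp; linear_combination h2
  have h5 : √(2 * K) * L * (√(2 * K) * b / kepMod K μ L) = 2 * K * (L * b) / kepMod K μ L := by
    linear_combination (L * b / kepMod K μ L) * h3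
  rw [kepCurve, cosh_kepExit hK hμ hb, sinh_kepExit, h4, h5]
  have hD' : (kepMod K μ L : ℂ) ≠ 0 := by exact_mod_cast hD.ne'
  have hK' : (K : ℂ) ≠ 0 := by exact_mod_cast hK.ne'
  push_cast
  field_simp
  ring

/-- For `L = 0` the derivative vanishes at `y = 0`, so positivity is used only for `y > 0`, and
oddness does the rest. -/
lemma kepTime_strictMono (hK : 0 < K) (hμ : 0 < μ) : StrictMono (kepTime K μ L) := by
  have hk : 0 < √(2 * K) := Real.sqrt_pos.mpr (by positivity)
  refine strictMono_of_odd_strictMonoOn_nonneg kepTime_neg ?_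
  refine strictMonoOn_of_deriv_pos (convex_Ici 0)
    (fun y _ => (hasDerivAt_kepTime y).continuousAt.continuousWithinAt) fun y hy => ?_
  rw [interior_Ici] at hy
  rw [(hasDerivAt_kepTime y).deriv]
  exact div_pos (kepRadius_pos_of_ne_zero hK hμ (ne_of_gt hy)) hk

lemma kepTime_surjective (hK : 0 < K) (hμ : 0 < μ) : Function.Surjective (kepTime K μ L) := by
  have hk : 0 < √(2 * K) := Real.sqrt_pos.mpr (by positivity)
  have htop : Tendsto (kepTime K μ L) atTop atTop := by
    -- This minorant of the numerator of `kepTime` on `y ≥ 0` comes from `kepMod ≥ μ` and `sinh y ≥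
    -- y / 2 + y² / 4`.
    have h1 : Tendsto (fun y : ℝ => y * (y * (μ / 4) - μ / 2)) atTop atTop :=
      tendsto_id.atTop_mul_atTop₀ (tendsto_atTop_add_const_right _ _
        (tendsto_id.atTop_mul_const (by positivity)))
    refine Tendsto.atTop_div_const (by positivity) (tendsto_atTop_mono' _ ?_ h1)
    filter_upwards [eventually_ge_atTop (0 : ℝ)] with y hy
    have h2 := Real.quadratic_le_exp_of_nonneg hy
    have h3 : Real.exp (-y) ≤ 1 := Real.exp_le_one_iff.mpr (by linarith)
    have h4 := le_kepMod (μ := μ) (L := L) hK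
    have h5 : y / 2 + y ^ 2 / 4 ≤ Real.sinh y := by rw [Real.sinh_eq]; linarith
    have h6 : 0 ≤ y / 2 + y ^ 2 / 4 := by positivity
    have h7 := mul_le_mul h4 h5 h6 (hμ.le.trans h4)
    linarith
  have hbot : Tendsto (kepTime K μ L) atBot atBot := by
    have h := tendsto_neg_atTop_atBot.comp (htop.comp tendsto_neg_atBot_atTop)
    refine h.congr fun y => ?_
    simp [kepTime_neg]
  exact Continuous.surjective (continuous_iff_continuousAt.mpr fun y =>
    (hasDerivAt_kepTime y).continuousAt) htop hbot

/-! ### Existence of inner arcs -/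

/-- The model hyperbola is rotated and run from `-y₁` to `y₁`, with time given by the inverse of
Kepler's equation and shifted by `τ` so as to start at `0`. Collision arcs come from the same
formula with `L = 0`. -/
lemma exists_innerArc {E h : ℝ} (hK : 0 < E + h) (hμ : 0 < μ) (hb0 : 0 < b)
    (hb : b ^ 2 + L ^ 2 = 2 * (E + h + μ)) {p : ℂ} (hp : ‖p‖ = 1) :
    ∃ T z v, IsInnerArc E h μ T z v ∧ z 0 = p ∧ (conj p * v 0).im = L := by
  set K := E + h with hKdef
  have hk : 0 < √(2 * K) := Real.sqrt_pos.mpr (by positivity)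
  set Y : ℝ ≃o ℝ := ((kepTime_strictMono (L := L) hK hμ).orderIsoOfSurjective _
    (kepTime_surjective hK hμ)).symm with hY
  have hGY : ∀ t, kepTime K μ L (Y t) = t := fun t =>
    ((kepTime_strictMono (L := L) hK hμ).orderIsoOfSurjective _
      (kepTime_surjective hK hμ)).apply_symm_apply t
  have hYG : ∀ y, Y (kepTime K μ L y) = y := fun y =>
    ((kepTime_strictMono (L := L) hK hμ).orderIsoOfSurjective _
      (kepTime_surjective hK hμ)).symm_apply_apply y
  have hYneg : ∀ t, Y (-t) = -Y t := fun t => by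
    rw [← hYG (-Y t), kepTime_neg, hGY]
  have hY0 : Y 0 = 0 := by have := hYneg 0; rw [neg_zero] at this; linarith
  -- The inverse of Kepler's equation is differentiable exactly as needed: wherever the radius does
  -- not vanish.
  have hYd : ∀ t, kepRadius K μ L (Y t) ≠ 0 →
      HasDerivAt Y (√(2 * K) / kepRadius K μ L (Y t)) t := fun t ht => by
    rw [← inv_div]
    exact HasDerivAt.of_local_left_inverse Y.continuous.continuousAt
      (hasDerivAt_kepTime (Y t)) (by positivity) (Eventually.of_forall hGY)
  set y₁ := kepExit K μ L b with hy₁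
  have hy₁0 : 0 < y₁ := kepExit_pos hK hμ hb0
  set τ := kepTime K μ L y₁ with hτ
  have hτ0 : 0 < τ := by
    have := kepTime_strictMono (L := L) hK hμ hy₁0
    have h0 : kepTime K μ L 0 = 0 := by simp [kepTime]
    rwa [h0] at this
  have hR1 : kepRadius K μ L y₁ = 1 := kepRadius_kepExit hK hμ hb
  have hU1 : ‖kepCurve K μ L y₁‖ = 1 := by rw [norm_kepCurve hK hμ, hR1]
  obtain ⟨c, hcn, hcU⟩ : ∃ c : ℂ, ‖c‖ = 1 ∧ c * kepCurve K μ L (-y₁) = p := by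
    -- The curve at `-y₁` is the conjugate of the unit number at `y₁`, hence its inverse.
    refine ⟨p * kepCurve K μ L y₁, by rw [norm_mul, hp, hU1, one_mul], ?_⟩
    rw [kepCurve_neg, mul_assoc, Complex.mul_conj', hU1]; simp
  have hcc : conj c * c = 1 := by rw [Complex.conj_mul', hcn]; simp
  have hc0 : c ≠ 0 := by rw [← norm_pos_iff, hcn]; exact one_pos
  set z : ℝ → ℂ := fun t => c * kepCurve K μ L (Y (t - τ)) with hz
  set v : ℝ → ℂ := fun t => c * (kepCurveDeriv K μ L (Y (t - τ)) *
    ((√(2 * K) / kepRadius K μ L (Y (t - τ)) : ℝ) : ℂ)) with hv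
  have hzn : ∀ t, ‖z t‖ = kepRadius K μ L (Y (t - τ)) := fun t => by
    rw [hz]; simp only; rw [norm_mul, hcn, one_mul, norm_kepCurve hK hμ]
  have hstart : Y (0 - τ) = -y₁ := by rw [zero_sub, hYneg, hτ, hYG]
  have hend : Y (τ + τ - τ) = y₁ := by rw [add_sub_cancel_right, hτ, hYG]
  have hz0 : z 0 = p := by
    rw [hz]; simp only
    rw [hstart, hcU]
  have hR1' : kepRadius K μ L (-y₁) = 1 := by
    rw [← norm_kepCurve hK hμ, kepCurve_neg, Complex.norm_conj, hU1]
  have hzd : ∀ t, kepRadius K μ L (Y (t - τ)) ≠ 0 → HasDerivAt z (v t) t := fun t ht => by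
    have h1 := (hYd (t - τ) ht).comp_sub_const t τ
    have h2 := ((hasDerivAt_kepCurve (K := K) (μ := μ) (L := L) (Y (t - τ))).scomp t h1).const_mul c
    refine h2.congr_deriv ?_
    simp only [hv, Complex.real_smul]; ring
  have hvd : ∀ t, kepRadius K μ L (Y (t - τ)) ≠ 0 →
      HasDerivAt v (gradient (VI E h μ) (z t)) t := fun t ht => by
    have h1 := (hYd (t - τ) ht).comp_sub_const t τ
    have h2 := (hasDerivAt_kepCurveDeriv (K := K) (μ := μ) (L := L) (Y (t - τ))).scomp t h1
    have h3 := HasDerivAt.comp t (h₂ := kepRadius K μ L) (h := fun x => Y (x - τ))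
      (hasDerivAt_kepRadius _) h1
    have h4 := (h2.mul ((h3.inv (by exact ht)).const_mul √(2 * K)).ofReal_comp).const_mul c
    refine (h4.congr_deriv ?_).congr_of_eventuallyEq (Eventually.of_forall fun t => ?_)
    · have hzne : z t ≠ 0 := by
        rw [← norm_ne_zero_iff, hzn]; exact ht
      rw [gradient_VI E h μ hzne, hzn]
      have h5 := kepCurve_newton (μ := μ) (L := L) hK (Y (t - τ))
      have h6 := congrArg Complex.ofReal (sqrt_two_mul_sq hK)
      have hR' : (kepRadius K μ L (Y (t - τ)) : ℂ) ≠ 0 := by exact_mod_cast ht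
      have hK' : (K : ℂ) ≠ 0 := by exact_mod_cast hK.ne'
      simp only [hz, Function.comp, Pi.inv_apply, Complex.real_smul]
      generalize kepCurve K μ L (Y (t - τ)) = u at *
      generalize kepCurveDeriv K μ L (Y (t - τ)) = u' at *
      generalize kepRadius K μ L (Y (t - τ)) = R at *
      generalize hu : ((-(μ * Real.cosh (Y (t - τ))) : ℝ) +
        (√(2 * K) * L * Real.sinh (Y (t - τ)) : ℝ) * Complex.I) / ((2 * K : ℝ) : ℂ) = u'' at *
      generalize kepMod K μ L * Real.sinh (Y (t - τ)) / (2 * K) = R' at *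
      generalize √(2 * K) = k at *
      push_cast at h5 h6 ⊢
      field_simp at h5 ⊢
      linear_combination h5 + (u'' * R - u' * R') * h6
    · simp [hv, div_eq_mul_inv]
  have hen : ∀ t, kepRadius K μ L (Y (t - τ)) ≠ 0 → ‖v t‖ ^ 2 / 2 - VI E h μ (z t) = 0 :=
    fun t ht => by
    rw [VI, hzn, ← hKdef]
    simp only [hv]
    rw [norm_mul, norm_mul, hcn, one_mul, mul_pow, normSq_kepCurveDeriv hK, Complex.norm_real,
      Real.norm_eq_abs, sq_abs, div_pow, sqrt_two_mul_sq hK]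
    field_simp
    ring
  have hYc : Continuous fun t => kepCurve K μ L (Y (t - τ)) :=
    (continuous_iff_continuousAt.mpr fun y => (hasDerivAt_kepCurve y).continuousAt).comp
      (Y.continuous.comp (continuous_sub_right τ))
  refine ⟨τ + τ, z, v, ⟨by positivity, by rw [hz0, hp], ?_, ?_, ?_⟩, hz0, ?_⟩
  · rw [hzn, hend, hR1]
  · intro s hs
    have h1 : Y (s - τ) < y₁ := by rw [← hend]; exact Y.strictMono (by linarith [hs.2])
    have h2 : -y₁ < Y (s - τ) := by rw [← hstart]; exact Y.strictMono (by linarith [hs.1])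
    rw [hzn, ← hR1, kepRadius, kepRadius]
    have h3 : Real.cosh (Y (s - τ)) < Real.cosh y₁ := by
      rw [Real.cosh_lt_cosh, abs_of_pos hy₁0]; exact abs_lt.mpr ⟨h2, h1⟩
    have h4 := kepMod_pos (L := L) hK hμ
    gcongr
  · by_cases hL : L = 0
    -- For `L = 0` the curve is real and even in `y`, so the second half of the motion retraces the
    -- first; the centre is reached only at `y = 0`, that is at time `τ`.
    · right
      have hzero : ∀ s, z s = 0 ↔ s = (τ + τ) / 2 := fun s => by
        rw [← norm_eq_zero, hzn]
        constructor
        · intro h0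
          by_contra hne
          refine (kepRadius_pos_of_ne_zero (L := L) hK hμ fun hy => hne ?_).ne' h0
          rw [← hY0] at hy
          have := Y.injective hy
          linarith
        · rintro rfl
          rw [show (τ + τ) / 2 - τ = 0 by ring, hY0, kepRadius, kepMod, hL, Real.cosh_zero]
          simp [Real.sqrt_sq hμ.le]
      have hne : ∀ s ∈ Icc 0 (τ + τ) \ {(τ + τ) / 2}, kepRadius K μ L (Y (s - τ)) ≠ 0 :=
        fun s hs h0 => hs.2 ((hzero s).mp (by rw [← norm_eq_zero, hzn, h0]))
      refine ⟨(continuous_const.mul hYc).continuousOn, fun s _ => hzero s,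
        ⟨fun s hs => (hzd s (hne s hs)).hasDerivWithinAt,
          fun s hs => (hvd s (hne s hs)).hasDerivWithinAt, fun s hs => hen s (hne s hs)⟩,
        fun s _ => ?_⟩
      simp only [hz]
      rw [show τ + τ - s - τ = -(s - τ) by ring, hYneg]
      simp [kepCurve, hL]
    · left
      have hne : ∀ s, kepRadius K μ L (Y (s - τ)) ≠ 0 := fun s => (kepRadius_pos hK hμ hL _).ne'
      refine ⟨fun s _ => ?_, ⟨fun s _ => (hzd s (hne s)).hasDerivWithinAt,
          fun s _ => (hvd s (hne s)).hasDerivWithinAt, fun s _ => hen s (hne s)⟩⟩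
      rw [← norm_ne_zero_iff, hzn]
      exact hne s
  · have h1 : conj p * v 0 = conj (kepCurve K μ L (-y₁)) * kepCurveDeriv K μ L (-y₁) * √(2 * K) := by
      rw [← hz0]
      simp only [hz, hv]
      rw [hstart, hR1', div_one, map_mul]
      linear_combination (conj (kepCurve K μ L (-y₁)) * kepCurveDeriv K μ L (-y₁) * √(2 * K)) * hcc
    rw [h1, conj_kepCurve_mul_deriv hK, hR1']
    have hk' : (√(2 * K) : ℂ) ≠ 0 := by exact_mod_cast hk.ne'
    rw [Complex.im_mul_ofReal, Complex.im_ofReal_mul, im_add_mul_I]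
    field_simp

end

section

/-! ### Uniqueness of inner arcs -/

/-- The exceptional time `c` allows for a collision, where only continuity is available. -/
lemma eq_of_hasDerivAt_zero_off {F : ℝ → ℂ} {a b c : ℝ} (hab : a ≤ b)
    (hF : ContinuousOn F (Icc a b))
    (hd : ∀ t ∈ Ioo a b, t ≠ c → HasDerivAt F 0 t) : F b = F a := by
  have h := MeasureTheory.integral_eq_of_hasDerivAt_off_countable_of_le F (fun _ => 0) hab
    (countable_singleton c) hF (fun t ht => hd t ht.1 ht.2) intervalIntegrable_const
  rw [intervalIntegral.integral_zero] at h
  exact (sub_eq_zero.mp h.symm)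

/-- The derivative of a continuous function is integrable as soon as it is nonnegative, even if it
is unbounded near `c`. This gives convergence of the integrals of `μ / |z|` and of the Jacobi
density through a collision. -/
lemma integral_eq_sub_of_nonneg_off {F F' : ℝ → ℝ} {a b c : ℝ} (hc : c ∈ Ioo a b)
    (hF : ContinuousOn F (Icc a b)) (hd : ∀ t ∈ Ioo a b, t ≠ c → HasDerivAt F (F' t) t)
    (hpos : ∀ t, 0 ≤ F' t) : ∫ t in a..b, F' t = F b - F a := by
  have h1 : IntervalIntegrable F' MeasureTheory.volume a c := by
    refine intervalIntegral.intervalIntegrable_deriv_of_nonneg (g := F) ?_ ?_ fun t _ => hpos t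
    · rw [uIcc_of_le hc.1.le]; exact hF.mono (Icc_subset_Icc_right hc.2.le)
    · rw [min_eq_left hc.1.le, max_eq_right hc.1.le]
      exact fun t ht => hd t ⟨ht.1, ht.2.trans hc.2⟩ ht.2.ne
  have h2 : IntervalIntegrable F' MeasureTheory.volume c b := by
    refine intervalIntegral.intervalIntegrable_deriv_of_nonneg (g := F) ?_ ?_ fun t _ => hpos t
    · rw [uIcc_of_le hc.2.le]; exact hF.mono (Icc_subset_Icc_left hc.1.le)
    · rw [min_eq_left hc.2.le, max_eq_right hc.2.le]
      exact fun t ht => hd t ⟨hc.1.trans ht.1, ht.2⟩ ht.1.ne'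
  exact MeasureTheory.integral_eq_of_hasDerivAt_off_countable_of_le F F' (hc.1.trans hc.2).le
    (countable_singleton c) hF (fun t ht => hd t ht.1 ht.2) (h1.trans h2)

variable {E h μ T L b : ℝ} {z v : ℝ → ℂ}

lemma IsInnerArc.continuousOn (H : IsInnerArc E h μ T z v) : ContinuousOn z (Icc 0 T) := by
  rcases H.solves with ⟨_, hs⟩ | hs
  · exact fun t ht => (hs.velocity t ht).continuousWithinAt
  · exact hs.continuousOn

/-- Dropping the time `T / 2` also for classical solutions allows a common treatment of both kinds
of arcs. -/
lemma IsInnerArc.solvesOn (H : IsInnerArc E h μ T z v) :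
    SolvesOn (VI E h μ) (Icc 0 T \ {T / 2}) z v := by
  rcases H.solves with ⟨_, hs⟩ | hs
  · exact ⟨fun s hs' => (hs.velocity s hs'.1).mono sdiff_subset,
      fun s hs' => (hs.newton s hs'.1).mono sdiff_subset, fun s hs' => hs.energy s hs'.1⟩
  · exact hs.solves

lemma IsInnerArc.ne_zero (H : IsInnerArc E h μ T z v) {t : ℝ} (ht : t ∈ Icc 0 T)
    (hne : t ≠ T / 2) : z t ≠ 0 := by
  rcases H.solves with ⟨hs, _⟩ | hs
  · exact hs t ht
  · exact fun h0 => hne ((hs.collision t ht).mp h0)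

/-- Multiplying the energy relation by `|z|²` removes the singularity, so this form also holds at a
collision. -/
lemma IsInnerArc.norm_sq_momentum (H : IsInnerArc E h μ T z v) {t : ℝ} (ht : t ∈ Icc 0 T) :
    ‖conj (z t) * v t‖ ^ 2 = 2 * (E + h) * ‖z t‖ ^ 2 + 2 * μ * ‖z t‖ := by
  rcases eq_or_ne (z t) 0 with h0 | h0
  · simp [h0]
  · have hen : ‖v t‖ ^ 2 / 2 - VI E h μ (z t) = 0 := by
      rcases H.solves with ⟨_, hs⟩ | hs
      · exact hs.energy t ht
      · exact hs.solves.energy t ⟨ht, fun h1 => h0 ((hs.collision t ht).mpr h1)⟩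
    have h1 : ‖z t‖ ≠ 0 := norm_ne_zero_iff.mpr h0
    rw [VI] at hen
    have h2 : ‖v t‖ ^ 2 = 2 * (E + h + μ / ‖z t‖) := by linarith
    rw [norm_mul, Complex.norm_conj, mul_pow, h2]
    field_simp

lemma diff_singleton_mem_nhds {t c T : ℝ} (ht : t ∈ Ioo 0 T) (hne : t ≠ c) :
    Icc 0 T \ {c} ∈ 𝓝 t :=
  inter_mem (Icc_mem_nhds ht.1 ht.2) (compl_singleton_mem_nhds hne)

/-- The value is real: its vanishing imaginary part is conservation of angular momentum, and its
real part is the Lagrange–Jacobi identity. -/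
lemma momentum_deriv {z v : ℂ} (hz : z ≠ 0) (hen : ‖v‖ ^ 2 / 2 - VI E h μ z = 0) :
    conj v * v + conj z * gradient (VI E h μ) z = ((2 * (E + h) + μ / ‖z‖ : ℝ) : ℂ) := by
  rw [gradient_VI E h μ hz]
  have h1 : ‖z‖ ≠ 0 := norm_ne_zero_iff.mpr hz
  have h1' : (‖z‖ : ℂ) ≠ 0 := by exact_mod_cast h1
  rw [VI] at hen
  have h2 : ‖v‖ ^ 2 = 2 * (E + h + μ / ‖z‖) := by linarith
  have h3 := congrArg Complex.ofReal h2
  have h4 := Complex.conj_mul' v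
  have h5 := Complex.conj_mul' z
  have h6 : conj z * (-((μ : ℂ) / ‖z‖ ^ 3) * z) = -((μ : ℂ) / ‖z‖) := by
    field_simp
    linear_combination (-μ : ℂ) * h5
  rw [h6, h4]
  push_cast at h3 ⊢
  linear_combination h3

lemma IsInnerArc.hasDerivWithinAt_momentum (H : IsInnerArc E h μ T z v) {t : ℝ}
    (ht : t ∈ Icc 0 T) (hne : t ≠ T / 2) :
    HasDerivWithinAt (fun t => conj (z t) * v t) ((2 * (E + h) + μ / ‖z t‖ : ℝ) : ℂ)
      (Icc 0 T \ {T / 2}) t := by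
  have ht' : t ∈ Icc 0 T \ {T / 2} := ⟨ht, hne⟩
  rw [← momentum_deriv (H.ne_zero ht hne) (H.solvesOn.energy t ht')]
  exact hasDerivWithinAt_conj_mul (H.solvesOn.velocity t ht') (H.solvesOn.newton t ht')

lemma IsInnerArc.hasDerivAt_momentum (H : IsInnerArc E h μ T z v) {t : ℝ}
    (ht : t ∈ Ioo 0 T) (hne : t ≠ T / 2) :
    HasDerivAt (fun t => conj (z t) * v t) ((2 * (E + h) + μ / ‖z t‖ : ℝ) : ℂ) t :=
  (H.hasDerivWithinAt_momentum (Ioo_subset_Icc_self ht) hne).hasDerivAt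
    (diff_singleton_mem_nhds ht hne)

lemma IsInnerArc.continuousOn_momentum (H : IsInnerArc E h μ T z v) :
    ContinuousOn (fun t => conj (z t) * v t) (Icc 0 T) := by
  intro t ht
  rcases eq_or_ne t (T / 2) with hne | hne
  · rcases H.solves with ⟨_, hs⟩ | hs
    · exact (hasDerivWithinAt_conj_mul (hs.velocity t ht) (hs.newton t ht)).continuousWithinAt
    -- At the collision the value of `v` is arbitrary, but `z = 0` forces the momentum to be `0`,
    -- which is also its limit by `norm_sq_momentum`.
    · have hz0 : z t = 0 := (hs.collision t ht).mpr hne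
      have h1 : Tendsto (fun s => ‖z s‖) (𝓝[Icc 0 T] t) (𝓝 0) := by
        have := (H.continuousOn t ht).norm.tendsto
        rwa [hz0, norm_zero] at this
      have h2 : Tendsto (fun s => √(2 * (E + h) * ‖z s‖ ^ 2 + 2 * μ * ‖z s‖))
          (𝓝[Icc 0 T] t) (𝓝 0) := by
        have := (((h1.pow 2).const_mul (2 * (E + h))).add (h1.const_mul (2 * μ))).sqrt
        simpa using this
      rw [ContinuousWithinAt, hz0, map_zero, zero_mul, tendsto_zero_iff_norm_tendsto_zero]
      refine h2.congr' ?_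
      filter_upwards [self_mem_nhdsWithin] with s hs'
      rw [← H.norm_sq_momentum hs', Real.sqrt_sq (norm_nonneg _)]
  · exact (H.hasDerivWithinAt_momentum ht hne).continuousWithinAt.mono_of_mem_nhdsWithin
      (inter_mem self_mem_nhdsWithin (mem_nhdsWithin_of_mem_nhds (compl_singleton_mem_nhds hne)))

/-- Conservation of the angular momentum, also through a collision. -/
lemma IsInnerArc.momentum_im (H : IsInnerArc E h μ T z v) {t : ℝ} (ht : t ∈ Icc 0 T) :
    (conj (z t) * v t).im = (conj (z 0) * v 0).im := by
  have h1 := eq_of_hasDerivAt_zero_off (F := fun t => ((conj (z t) * v t).im : ℂ)) (c := T / 2)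
    ht.1 (Complex.continuous_ofReal.comp_continuousOn (Complex.continuous_im.comp_continuousOn
      (H.continuousOn_momentum.mono (Icc_subset_Icc_right ht.2)))) (fun s hs hne => by
      have h2 := (Complex.imCLM.hasFDerivAt.comp_hasDerivAt s
        (H.hasDerivAt_momentum ⟨hs.1, hs.2.trans_le ht.2⟩ hne)).ofReal_comp
      refine HasDerivAt.congr_deriv h2 ?_
      simp only [Complex.imCLM_apply, Complex.ofReal_im, Complex.ofReal_zero])
  exact_mod_cast h1

lemma IsInnerArc.half_mem (H : IsInnerArc E h μ T z v) : T / 2 ∈ Ioo 0 T :=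
  ⟨by linarith [H.pos], by linarith [H.pos]⟩

/-- The radial components of the momentum at the ends of an inner arc. -/
lemma IsInnerArc.momentum_re_ends (H : IsInnerArc E h μ T z v) (hK : 0 < E + h) (hμ : 0 < μ)
    (hb0 : 0 < b) (hb : b ^ 2 + L ^ 2 = 2 * (E + h + μ)) (hL : (conj (z 0) * v 0).im = L) :
    (conj (z 0) * v 0).re = -b ∧ (conj (z T) * v T).re = b := by
  have hT := H.pos
  have h0 := H.norm_sq_momentum (left_mem_Icc.mpr hT.le)
  have h1 := H.norm_sq_momentum (right_mem_Icc.mpr hT.le)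
  rw [Complex.sq_norm, Complex.normSq_apply, H.start, hL] at h0
  rw [Complex.sq_norm, Complex.normSq_apply, H.finish, H.momentum_im (right_mem_Icc.mpr hT.le),
    hL] at h1
  -- The energy leaves `±b` at each end. The radial momentum minus `2 (E + h) t` does not decrease,
  -- so the radial momentum itself strictly increases, and only `-b` to `b` is possible.
  have h2 := integral_eq_sub_of_nonneg_off (F := fun t => (conj (z t) * v t).re - 2 * (E + h) * t)
    (F' := fun t => μ / ‖z t‖) H.half_mem
    ((Complex.continuous_re.comp_continuousOn H.continuousOn_momentum).sub (by fun_prop))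
    (fun t ht hne => by
      refine ((Complex.reCLM.hasFDerivAt.comp_hasDerivAt t (H.hasDerivAt_momentum ht hne)).sub
        ((hasDerivAt_id t).const_mul (2 * (E + h)))).congr_deriv ?_
      simp only [Complex.reCLM_apply, Complex.ofReal_re]
      ring)
    (fun t => by positivity)
  have h3 : 0 ≤ ∫ t in (0 : ℝ)..T, μ / ‖z t‖ :=
    intervalIntegral.integral_nonneg hT.le fun t _ => by positivity
  rw [h2] at h3
  simp only [mul_zero, sub_zero] at h3
  have h4 : 0 < 2 * (E + h) * T := by positivity
  have h5 : (conj (z 0) * v 0).re = b ∨ (conj (z 0) * v 0).re = -b :=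
    sq_eq_sq_iff_eq_or_eq_neg.mp (by linarith)
  have h6 : (conj (z T) * v T).re = b ∨ (conj (z T) * v T).re = -b :=
    sq_eq_sq_iff_eq_or_eq_neg.mp (by linarith)
  rcases h5 with h5 | h5 <;> rcases h6 with h6 | h6 <;> first | exact ⟨h5, h6⟩ | (exfalso; linarith)

/-- The parameter of `kepCurve` along an inner arc. -/
def kepParam (K μ L : ℝ) (W : ℂ) : ℝ := Real.arsinh (√(2 * K) * W.re / kepMod K μ L)

lemma sinh_kepParam (K μ L : ℝ) (W : ℂ) :
    Real.sinh (kepParam K μ L W) = √(2 * K) * W.re / kepMod K μ L := Real.sinh_arsinh _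

/-- The root is the hyperbolic cosine of `kepParam`; the energy relation and the conserved angular
momentum express it through the distance to the centre. -/
lemma IsInnerArc.cosh_kepParam (H : IsInnerArc E h μ T z v) (hK : 0 < E + h) (hμ : 0 < μ)
    (hL : (conj (z 0) * v 0).im = L) {t : ℝ} (ht : t ∈ Icc 0 T) :
    √(1 + (√(2 * (E + h)) * (conj (z t) * v t).re / kepMod (E + h) μ L) ^ 2) =
      (2 * (E + h) * ‖z t‖ + μ) / kepMod (E + h) μ L := by
  have hD := kepMod_pos (L := L) hK hμ
  have h2 := kepMod_sq (μ := μ) (L := L) hK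
  have h1 := H.norm_sq_momentum ht
  rw [Complex.sq_norm, Complex.normSq_apply, H.momentum_im ht, hL] at h1
  rw [div_pow, mul_pow, sqrt_two_mul_sq hK]
  rw [show 1 + 2 * (E + h) * (conj (z t) * v t).re ^ 2 / kepMod (E + h) μ L ^ 2 =
    ((2 * (E + h) * ‖z t‖ + μ) / kepMod (E + h) μ L) ^ 2 by
    field_simp; linear_combination h2 + 2 * (E + h) * h1]
  exact Real.sqrt_sq (by positivity)

/-- Thus `kepParam` runs as the regularized time of the model curve, and an arc can be compared with
`kepCurve`. -/
lemma IsInnerArc.hasDerivAt_kepParam (H : IsInnerArc E h μ T z v) (hK : 0 < E + h) (hμ : 0 < μ)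
    (hL : (conj (z 0) * v 0).im = L) {t : ℝ} (ht : t ∈ Ioo 0 T) (hne : t ≠ T / 2) :
    HasDerivAt (fun t => kepParam (E + h) μ L (conj (z t) * v t))
      (√(2 * (E + h)) / ‖z t‖) t := by
  have hD := kepMod_pos (L := L) hK hμ
  have ht' := Ioo_subset_Icc_self ht
  have hz : 0 < ‖z t‖ := norm_pos_iff.mpr (H.ne_zero ht' hne)
  have h1 := Complex.reCLM.hasFDerivAt.comp_hasDerivAt t (H.hasDerivAt_momentum ht hne)
  have h2 := ((h1.const_mul √(2 * (E + h))).div_const (kepMod (E + h) μ L)).arsinh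
  refine HasDerivAt.congr_deriv h2 ?_
  simp only [Function.comp, Complex.reCLM_apply, Complex.ofReal_re]
  rw [H.cosh_kepParam hK hμ hL ht', smul_eq_mul]
  field_simp

lemma IsInnerArc.continuousOn_kepParam (H : IsInnerArc E h μ T z v) :
    ContinuousOn (fun t => kepParam (E + h) μ L (conj (z t) * v t)) (Icc 0 T) := by
  have h1 := Complex.continuous_re.comp_continuousOn H.continuousOn_momentum
  exact Real.continuous_arsinh.comp_continuousOn ((h1.const_mul _).div_const _)

lemma IsInnerArc.kepParam_ends (H : IsInnerArc E h μ T z v) (hK : 0 < E + h) (hμ : 0 < μ)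
    (hb0 : 0 < b) (hb : b ^ 2 + L ^ 2 = 2 * (E + h + μ)) (hL : (conj (z 0) * v 0).im = L) :
    kepParam (E + h) μ L (conj (z 0) * v 0) = -kepExit (E + h) μ L b ∧
    kepParam (E + h) μ L (conj (z T) * v T) = kepExit (E + h) μ L b := by
  obtain ⟨h0, h1⟩ := H.momentum_re_ends hK hμ hb0 hb hL
  rw [kepParam, kepParam, kepExit, h0, h1, mul_neg, neg_div, Real.arsinh_neg]
  exact ⟨rfl, rfl⟩

lemma IsInnerArc.kepRadius_kepParam (H : IsInnerArc E h μ T z v) (hK : 0 < E + h) (hμ : 0 < μ)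
    (hL : (conj (z 0) * v 0).im = L) {t : ℝ} (ht : t ∈ Icc 0 T) :
    kepRadius (E + h) μ L (kepParam (E + h) μ L (conj (z t) * v t)) = ‖z t‖ := by
  have hD := kepMod_pos (L := L) hK hμ
  rw [kepRadius, kepParam, Real.cosh_arsinh, H.cosh_kepParam hK hμ hL ht]
  field_simp
  ring

/-- Kepler's equation: `kepTime` evaluated along the arc differs from `t` by a constant, also across
a collision. -/
lemma IsInnerArc.duration_eq (H : IsInnerArc E h μ T z v) (hK : 0 < E + h) (hμ : 0 < μ)
    (hb0 : 0 < b) (hb : b ^ 2 + L ^ 2 = 2 * (E + h + μ)) (hL : (conj (z 0) * v 0).im = L) :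
    T = 2 * kepTime (E + h) μ L (kepExit (E + h) μ L b) := by
  have hk : 0 < √(2 * (E + h)) := Real.sqrt_pos.mpr (by positivity)
  have hD := kepMod_pos (L := L) hK hμ
  have hT := H.pos
  obtain ⟨h0, h1⟩ := H.kepParam_ends hK hμ hb0 hb hL
  have h2 := eq_of_hasDerivAt_zero_off (c := T / 2)
    (F := fun t => ((kepTime (E + h) μ L (kepParam (E + h) μ L (conj (z t) * v t)) - t : ℝ) : ℂ))
    hT.le (Complex.continuous_ofReal.comp_continuousOn
      (((continuous_iff_continuousAt.mpr fun y => (hasDerivAt_kepTime y).continuousAt)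
        |>.comp_continuousOn H.continuousOn_kepParam).sub continuousOn_id))
    (fun t ht hne => by
      have ht' := Ioo_subset_Icc_self ht
      have hz : 0 < ‖z t‖ := norm_pos_iff.mpr (H.ne_zero ht' hne)
      have h3 := (((hasDerivAt_kepTime (K := E + h) (μ := μ) (L := L) _).comp t (H.hasDerivAt_kepParam hK hμ hL ht hne)).sub
        (hasDerivAt_id t)).ofReal_comp
      refine HasDerivAt.congr_deriv h3 ?_
      rw [H.kepRadius_kepParam hK hμ hL ht']
      norm_cast
      field_simp
      simp)
  rw [h0, h1, kepTime_neg] at h2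
  have h3 := Complex.ofReal_injective h2
  linarith

/-- The radial momentum has derivative `2 (E + h) + μ / |z| = V + (E + h)`, so subtracting `(E + h)
t` gives a primitive of `V`. Kepler's equation then eliminates the duration. -/
lemma IsInnerArc.jacobiLength_eq (H : IsInnerArc E h μ T z v) (hK : 0 < E + h) (hμ : 0 < μ)
    (hb0 : 0 < b) (hb : b ^ 2 + L ^ 2 = 2 * (E + h + μ)) (hL : (conj (z 0) * v 0).im = L) :
    jacobiLength (VI E h μ) T z v =
      √2 * (b + μ * kepExit (E + h) μ L b / √(2 * (E + h))) := by
  have hk : 0 < √(2 * (E + h)) := Real.sqrt_pos.mpr (by positivity)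
  have hD := kepMod_pos (L := L) hK hμ
  obtain ⟨h0, h1⟩ := H.momentum_re_ends hK hμ hb0 hb hL
  have h2 := integral_eq_sub_of_nonneg_off
    (F := fun t => √2 * ((conj (z t) * v t).re - (E + h) * t))
    (F' := fun t => ‖v t‖ * √(VI E h μ (z t))) H.half_mem
    (((Complex.continuous_re.comp_continuousOn H.continuousOn_momentum).sub
      (by fun_prop)).const_mul _)
    (fun t ht hne => by
      refine (((Complex.reCLM.hasFDerivAt.comp_hasDerivAt t (H.hasDerivAt_momentum ht hne)).sub
        ((hasDerivAt_id t).const_mul (E + h))).const_mul √2).congr_deriv ?_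
      rw [norm_mul_sqrt_of_energy (H.solvesOn.energy t ⟨Ioo_subset_Icc_self ht, hne⟩), VI]
      simp only [Complex.reCLM_apply, Complex.ofReal_re]
      ring)
    (fun t => by positivity)
  rw [jacobiLength, h2, h0, h1]
  have h3 := H.duration_eq hK hμ hb0 hb hL
  rw [kepTime, sinh_kepExit, mul_div_cancel₀ _ hD.ne'] at h3
  have h4 : (E + h) * T = b - μ * kepExit (E + h) μ L b / √(2 * (E + h)) := by
    rw [h3]; field_simp
  rw [h4]
  ring

/-- Inner arcs without angular momentum are ejection-collision arcs. -/
lemma IsInnerArc.bounce_of_eq_zero (H : IsInnerArc E h μ T z v) (hK : 0 < E + h) (hμ : 0 < μ)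
    (hL : (conj (z 0) * v 0).im = 0) : z T = z 0 := by
  have hT := H.pos
  rcases H.solves with ⟨hne, _⟩ | hs
  · exfalso
    have hb : √(2 * (E + h + μ)) ^ 2 + (0 : ℝ) ^ 2 = 2 * (E + h + μ) := by
      rw [Real.sq_sqrt (by positivity)]; ring
    have hb0 : 0 < √(2 * (E + h + μ)) := Real.sqrt_pos.mpr (by positivity)
    obtain ⟨h0, h1⟩ := H.momentum_re_ends hK hμ hb0 hb hL
    -- The radial momentum changes sign; at its zero the whole momentum vanishes, which is
    -- impossible away from the centre.
    obtain ⟨t, ht, hre⟩ := intermediate_value_Icc hT.le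
      (Complex.continuous_re.comp_continuousOn H.continuousOn_momentum)
      (show (0 : ℝ) ∈ Icc _ _ from ⟨by
        change (conj (z 0) * v 0).re ≤ 0; linarith, by
        change 0 ≤ (conj (z T) * v T).re; linarith⟩)
    have h2 := H.norm_sq_momentum ht
    have h3 : (conj (z t) * v t).re = 0 := hre
    rw [Complex.sq_norm, Complex.normSq_apply, h3, H.momentum_im ht, hL] at h2
    have h4 : 0 < ‖z t‖ := norm_pos_iff.mpr (hne t ht)
    have : 0 < 2 * (E + h) * ‖z t‖ ^ 2 + 2 * μ * ‖z t‖ := by positivity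
    linarith
  · have := hs.bounce 0 (left_mem_Icc.mpr hT.le)
    rwa [sub_zero] at this

/-- An inner arc with angular momentum is classical. -/
lemma IsInnerArc.classical_of_ne_zero (H : IsInnerArc E h μ T z v)
    (hL : (conj (z 0) * v 0).im ≠ 0) : IsClassicalInner E h μ T z v := by
  rcases H.solves with hs | hs
  · exact hs
  · exfalso
    have ht := Ioo_subset_Icc_self H.half_mem
    have h1 := H.momentum_im ht
    rw [(hs.collision _ ht).mpr rfl, map_zero, zero_mul, Complex.zero_im] at h1
    exact hL h1.symm

/-- For `L ≠ 0` the arc and the model curve have the same modulus and the same momentum, so their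
quotient is constant. The model runs from `conj u` to `u` with `|u| = 1`, whence the factor `u²`.
For `L = 0` the arc returns to its start and the factor is `1`. -/
lemma IsInnerArc.end_point (H : IsInnerArc E h μ T z v) (hK : 0 < E + h) (hμ : 0 < μ)
    (hb0 : 0 < b) (hb : b ^ 2 + L ^ 2 = 2 * (E + h + μ)) (hL : (conj (z 0) * v 0).im = L) :
    z T = z 0 * (((μ - L ^ 2 : ℝ) - (L * b : ℝ) * Complex.I) / kepMod (E + h) μ L) ^ 2 := by
  have hT := H.pos
  have hk : 0 < √(2 * (E + h)) := Real.sqrt_pos.mpr (by positivity)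
  have hD := kepMod_pos (L := L) hK hμ
  rcases eq_or_ne L 0 with h0 | h0
  · rw [H.bounce_of_eq_zero hK hμ (hL.trans h0)]
    have h1 : kepMod (E + h) μ L = μ := by
      rw [kepMod, h0]; simp [Real.sqrt_sq hμ.le]
    have hμ' : (μ : ℂ) ≠ 0 := by exact_mod_cast hμ.ne'
    rw [h1, h0]
    simp [hμ']
  · obtain ⟨hne, hs⟩ := H.classical_of_ne_zero (by rw [hL]; exact h0)
    set y : ℝ → ℝ := fun t => kepParam (E + h) μ L (conj (z t) * v t) with hy
    have hUn : ∀ t ∈ Icc 0 T, ‖kepCurve (E + h) μ L (y t)‖ = ‖z t‖ := fun t ht => by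
      rw [norm_kepCurve hK hμ]; exact H.kepRadius_kepParam hK hμ hL ht
    have hU0 : ∀ t ∈ Icc 0 T, kepCurve (E + h) μ L (y t) ≠ 0 := fun t ht => by
      rw [← norm_ne_zero_iff, hUn t ht]; exact norm_ne_zero_iff.mpr (hne t ht)
    have h2 := eq_of_hasDerivAt_zero_off (c := T / 2)
      (F := fun t => z t / kepCurve (E + h) μ L (y t)) hT.le
      (H.continuousOn.div ((continuous_iff_continuousAt.mpr fun y =>
        (hasDerivAt_kepCurve y).continuousAt).comp_continuousOn H.continuousOn_kepParam) hU0)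
      (fun t ht hne' => by
        have ht' := Ioo_subset_Icc_self ht
        have hz : z t ≠ 0 := hne t ht'
        have hzn : ‖z t‖ ≠ 0 := norm_ne_zero_iff.mpr hz
        have hzn' : (‖z t‖ : ℂ) ≠ 0 := by exact_mod_cast hzn
        have hzd : HasDerivAt z (v t) t :=
          (hs.velocity t ht').hasDerivAt (Icc_mem_nhds ht.1 ht.2)
        have hUd := (hasDerivAt_kepCurve (K := E + h) (μ := μ) (L := L) (y t)).scomp t
          (H.hasDerivAt_kepParam hK hμ hL ht hne')
        refine (hzd.div hUd (hU0 t ht')).congr_deriv ?_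
        have h3 := conj_kepCurve_mul_deriv (μ := μ) (L := L) hK (y t)
        have h4 : kepMod (E + h) μ L * Real.sinh (y t) / √(2 * (E + h)) =
            (conj (z t) * v t).re := by
          simp only [hy]; rw [sinh_kepParam]; field_simp
        have h5 : (((conj (z t) * v t).re : ℂ) + L * Complex.I) = conj (z t) * v t := by
          rw [← hL, ← H.momentum_im ht', Complex.re_add_im]
        have h6 : kepRadius (E + h) μ L (y t) = ‖z t‖ := H.kepRadius_kepParam hK hμ hL ht'
        have h7 := Complex.mul_conj' (kepCurve (E + h) μ L (y t))
        have h8 := Complex.mul_conj' (z t)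
        rw [hUn t ht'] at h7
        rw [h4, h5, h6] at h3
        rw [div_eq_zero_iff]
        left
        simp only [Function.comp, Complex.real_smul]
        change v t * kepCurve (E + h) μ L (y t) -
          z t * (((√(2 * (E + h)) / ‖z t‖ : ℝ) : ℂ) * kepCurveDeriv (E + h) μ L (y t)) = 0
        generalize kepCurve (E + h) μ L (y t) = u at *
        generalize kepCurveDeriv (E + h) μ L (y t) = u' at *
        have hk' : (√(2 * (E + h)) : ℂ) ≠ 0 := by exact_mod_cast hk.ne'
        push_cast at h3 ⊢
        generalize (√(2 * (E + h)) : ℂ) = k at *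
        field_simp at h3 ⊢
        have h9 : (‖z t‖ : ℂ) ^ 2 * (v t * u * ‖z t‖ - z t * k * u') = 0 := by
          linear_combination (v t * u * ‖z t‖) * (-h8) + z t * k * u' * h7 - z t * u * h3
        rcases mul_eq_zero.mp h9 with h10 | h10
        · exact absurd h10 (pow_ne_zero 2 hzn')
        · linear_combination h10)
    have hu := kepCurve_kepExit (L := L) hK hμ hb
    obtain ⟨e0, e1⟩ := H.kepParam_ends hK hμ hb0 hb hL
    have hn : ‖kepCurve (E + h) μ L (kepExit (E + h) μ L b)‖ = 1 := by
      rw [norm_kepCurve hK hμ, kepRadius_kepExit hK hμ hb]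
    simp only [hy] at h2
    rw [e0, e1, kepCurve_neg] at h2
    have hcc := Complex.mul_conj' (kepCurve (E + h) μ L (kepExit (E + h) μ L b))
    rw [hn] at hcc
    have hsq : (((μ - L ^ 2 : ℝ) - (L * b : ℝ) * Complex.I) / kepMod (E + h) μ L) ^ 2 =
        kepCurve (E + h) μ L (kepExit (E + h) μ L b) ^ 2 := by rw [hu]; ring
    rw [hsq]
    generalize kepCurve (E + h) μ L (kepExit (E + h) μ L b) = u at *
    have hu0 : u ≠ 0 := by rw [← norm_pos_iff, hn]; exact one_pos
    have hcu0 : conj u ≠ 0 := by simpa using hu0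
    push_cast at hcc
    field_simp at h2
    linear_combination u * h2 - z T * hcc

end

section

/-! ### Excursions -/

/-- The radial component of the inner velocity of the states of action `I`. -/
def innerRadial (E h μ I : ℝ) : ℝ := √(2 * (E + h + μ) - 2 * I ^ 2)

lemma innerRadial_pos {E h μ I : ℝ} (hI : I ^ 2 < E + h + μ) : 0 < innerRadial E h μ I :=
  Real.sqrt_pos.mpr (by linarith)

lemma innerRadial_sq {E h μ I : ℝ} (hI : I ^ 2 < E + h + μ) :
    innerRadial E h μ I ^ 2 + (√2 * I) ^ 2 = 2 * (E + h + μ) := by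
  rw [innerRadial, Real.sq_sqrt (by linarith), mul_pow, Real.sq_sqrt (by norm_num)]
  ring

lemma sqrt_two_mul_sub (B I : ℝ) : √(2 * B - 2 * I ^ 2) = √2 * √(B - I ^ 2) := by
  rw [← mul_sub, Real.sqrt_mul (by norm_num)]

lemma radialVelocity_eq (E ω I : ℝ) :
    radialVelocity E ω I = √2 * √(E - ω ^ 2 / 2 - I ^ 2) := by
  rw [← sqrt_two_mul_sub, radialVelocity]; congr 2; ring

lemma innerRadial_eq (E h μ I : ℝ) : innerRadial E h μ I = √2 * √(E + h + μ - I ^ 2) := by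
  rw [← sqrt_two_mul_sub, innerRadial]

lemma kepMod_eq (K μ I : ℝ) : kepMod K μ (√2 * I) = √(μ ^ 2 + 4 * K * I ^ 2) := by
  rw [kepMod, mul_pow, Real.sq_sqrt (by norm_num)]; congr 1; ring

lemma outer_factor_eq (E ω I : ℝ) :
    (((E - (√2 * I) ^ 2 : ℝ) : ℂ) + ((√2 * I) * radialVelocity E ω I : ℝ) * Complex.I) =
      shiftDir E (E - ω ^ 2 / 2) I := by
  have h2 : √2 ^ 2 = 2 := Real.sq_sqrt (by norm_num)
  rw [radialVelocity_eq, shiftDir, mul_pow, h2,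
    show √2 * I * (√2 * √(E - ω ^ 2 / 2 - I ^ 2)) = √2 ^ 2 * I * √(E - ω ^ 2 / 2 - I ^ 2) by ring,
    h2]

lemma inner_factor_eq (E h μ I : ℝ) :
    (((μ - (√2 * I) ^ 2 : ℝ) : ℂ) - ((√2 * I) * innerRadial E h μ I : ℝ) * Complex.I) =
      conj (shiftDir μ (E + h + μ) I) := by
  have h2 : √2 ^ 2 = 2 := Real.sq_sqrt (by norm_num)
  rw [innerRadial_eq, shiftDir, mul_pow, h2,
    show √2 * I * (√2 * √(E + h + μ - I ^ 2)) = √2 ^ 2 * I * √(E + h + μ - I ^ 2) by ring,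
    h2, map_add, map_mul, Complex.conj_ofReal, Complex.conj_ofReal, Complex.conj_I]
  ring

/-- The length of the outer arcs with action `I`. -/
def outerLength (E ω I : ℝ) : ℝ :=
  (E * outerTime E ω (radialVelocity E ω I) - radialVelocity E ω I) / √2

/-- The length of the inner arcs with action `I`. -/
def innerLength (E h μ I : ℝ) : ℝ :=
  √2 * (innerRadial E h μ I +
    μ * kepExit (E + h) μ (√2 * I) (innerRadial E h μ I) / √(2 * (E + h)))

section Excursions

variable {E h μ ω : ℝ}

lemma polarAngle_div_ofReal (z : ℂ) {r : ℝ} (hr : 0 < r) :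
    polarAngle (z / r) = polarAngle z := by
  rw [div_eq_mul_inv, ← Complex.ofReal_inv, polarAngle_mul_ofReal z (inv_pos.mpr hr)]

lemma conj_mul_mul_self {p : ℂ} (hp : ‖p‖ = 1) (c : ℂ) : conj p * (c * p) = c := by
  linear_combination -(eq_conj_mul_mul hp c)

lemma polarAngle_outer_end {T I : ℝ} {z v : ℝ → ℂ} (H : IsOuterArc E ω T z v) (hω : 0 < ω)
    (hE : ω ^ 2 / 2 < E) (hI : I ∈ Ioo (-Ic E ω) (Ic E ω))
    (hv : v 0 = (radialVelocity E ω I + (√2 * I : ℝ) * Complex.I) * z 0) :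
    polarAngle (z T) = polarAngle (z 0) + (f E ω I : Real.Angle) := by
  have hE0 : 0 < E := by nlinarith
  have hI2 := sq_lt_of_mem hI
  have ha := radialVelocity_pos hI
  have hz0 : z 0 ≠ 0 := by rw [← norm_pos_iff, H.start]; exact one_pos
  have hN := norm_outerPhase_pos (E := E) hω ha
  have hS := shiftDir_ne_zero hE0 hI2
  obtain ⟨-, h1, -⟩ := H.end_data hω ha (radialVelocity_sq hI) hv
  rw [h1, outer_factor_eq, polarAngle_mul hz0 (div_ne_zero hS (by exact_mod_cast hN.ne')),
    polarAngle_div_ofReal _ hN, f_eq hE hI2]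
  rfl

lemma polarAngle_inner_end {T I : ℝ} {z v : ℝ → ℂ} (H : IsInnerArc E h μ T z v)
    (hK : 0 < E + h) (hμ : 0 < μ) (hI : I ^ 2 < E + h + μ)
    (hL : (conj (z 0) * v 0).im = √2 * I) :
    polarAngle (z T) = polarAngle (z 0) + (g E h μ I : Real.Angle) := by
  have hz0 : z 0 ≠ 0 := by rw [← norm_pos_iff, H.start]; exact one_pos
  have hD := kepMod_pos (L := √2 * I) hK hμ
  have hS : conj (shiftDir μ (E + h + μ) I) ≠ 0 := by simpa using shiftDir_ne_zero hμ hI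
  have hS' : conj (shiftDir μ (E + h + μ) I) / (kepMod (E + h) μ (√2 * I) : ℂ) ≠ 0 :=
    div_ne_zero hS (by exact_mod_cast hD.ne')
  rw [H.end_point hK hμ (innerRadial_pos hI) (innerRadial_sq hI) hL, inner_factor_eq,
    polarAngle_mul hz0 (pow_ne_zero 2 hS'), sq, polarAngle_mul hS' hS',
    polarAngle_div_ofReal _ hD, g_eq hμ hI, polarAngle, polarAngle, Complex.arg_conj_coe_angle,
    ← Real.Angle.coe_neg, ← Real.Angle.coe_add, shiftArg]
  congr 2
  ring

lemma VE_pos (hE : ω ^ 2 / 2 < E) {p : ℂ} (hp : ‖p‖ = 1) : 0 < VE E ω p := by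
  rw [VE_of_norm_one E ω hp]; linarith

lemma VI_pos (hE : ω ^ 2 / 2 < E) (hV : ∀ z : ℂ, ‖z‖ = 1 → VE E ω z < VI E h μ z) {p : ℂ}
    (hp : ‖p‖ = 1) : 0 < VI E h μ p := (VE_pos hE hp).trans (hV p hp)

lemma IsInnerArc.energy_start {T : ℝ} {z v : ℝ → ℂ} (H : IsInnerArc E h μ T z v) :
    ‖v 0‖ ^ 2 / 2 - VI E h μ (z 0) = 0 :=
  H.solvesOn.energy 0 ⟨left_mem_Icc.mpr H.pos.le, H.half_mem.1.ne⟩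

lemma IsInnerArc.energy_finish {T : ℝ} {z v : ℝ → ℂ} (H : IsInnerArc E h μ T z v) :
    ‖v T‖ ^ 2 / 2 - VI E h μ (z T) = 0 :=
  H.solvesOn.energy T ⟨right_mem_Icc.mpr H.pos.le, H.half_mem.2.ne'⟩

lemma IsOuterArc.energy_finish {T : ℝ} {z v : ℝ → ℂ} (H : IsOuterArc E ω T z v) :
    ‖v T‖ ^ 2 / 2 - VE E ω (z T) = 0 :=
  H.solves.energy T (right_mem_Icc.mpr H.pos.le)

lemma IsOuterArc.finish_im {T a L : ℝ} {z v : ℝ → ℂ} (H : IsOuterArc E ω T z v) (hω : 0 < ω)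
    (ha : 0 < a) (hE : a ^ 2 + L ^ 2 = 2 * E - ω ^ 2) (hv : v 0 = (a + L * Complex.I) * z 0) :
    (conj (z T) * v T).im = L := by
  rw [(H.end_data hω ha hE hv).2.2, conj_mul_mul_self H.finish, ← Complex.ofReal_neg,
    im_add_mul_I]

variable {x y : OutState E ω}

lemma Excursion.start_velocity (X : Excursion E h μ ω x y) :
    X.vE 0 = (radialVelocity E ω (action x) + (√2 * action x : ℝ) * Complex.I) * X.zE 0 := by
  rw [X.start_vel, X.start_pos]; exact x.vel_eq

lemma Excursion.inner_start_im (X : Excursion E h μ ω x y) (hω : 0 < ω) (hE : ω ^ 2 / 2 < E)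
    (hV : ∀ z : ℂ, ‖z‖ = 1 → VE E ω z < VI E h μ z) :
    (conj (X.zI 0) * X.vI 0).im = √2 * action x := by
  have hI := x.action_mem
  have hs := X.snell_in
  rw [snell_iff (VE_pos hE X.outer.finish) (VI_pos hE hV X.outer.finish) X.outer.energy_finish
    (X.crossing ▸ X.inner_arc.energy_start), X.outer.finish_im hω (radialVelocity_pos hI)
    (radialVelocity_sq hI) X.start_velocity] at hs
  rw [X.crossing, hs]

/-- Angular momentum is conserved on each arc, and Snell's law preserves it at both crossings. -/
lemma Excursion.action_eq_action (X : Excursion E h μ ω x y) (hω : 0 < ω) (hE : ω ^ 2 / 2 < E)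
    (hV : ∀ z : ℂ, ‖z‖ = 1 → VE E ω z < VI E h μ z) : action y = action x := by
  have hs := X.snell_out
  rw [snell_iff (VE_pos hE X.inner_arc.finish) (VI_pos hE hV X.inner_arc.finish)
    (X.end_pos ▸ y.2.2.1) X.inner_arc.energy_finish,
    X.inner_arc.momentum_im (right_mem_Icc.mpr X.inner_arc.pos.le),
    X.inner_start_im hω hE hV, X.end_pos] at hs
  rw [action_eq y, hs]
  field_simp

lemma Excursion.polarAngle_outer (X : Excursion E h μ ω x y) (hω : 0 < ω)
    (hE : ω ^ 2 / 2 < E) :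
    polarAngle (X.zE X.TE) = polarAngle x.1.1 + (f E ω (action x) : Real.Angle) := by
  rw [polarAngle_outer_end X.outer hω hE x.action_mem X.start_velocity, X.start_pos]

lemma Excursion.polarAngle_inner (X : Excursion E h μ ω x y) (hμ : 0 < μ) (hω : 0 < ω)
    (hK : 0 < E + h) (hE : ω ^ 2 / 2 < E) (hV : ∀ z : ℂ, ‖z‖ = 1 → VE E ω z < VI E h μ z) :
    polarAngle y.1.1 = polarAngle (X.zE X.TE) + (g E h μ (action x) : Real.Angle) := by
  rw [← X.end_pos, polarAngle_inner_end X.inner_arc hK hμ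
    (sq_lt_of_VE_lt_VI hV (sq_lt_of_mem x.action_mem)) (X.inner_start_im hω hE hV), X.crossing]

lemma Excursion.polarAngle_end (X : Excursion E h μ ω x y) (hμ : 0 < μ) (hω : 0 < ω)
    (hK : 0 < E + h) (hE : ω ^ 2 / 2 < E) (hV : ∀ z : ℂ, ‖z‖ = 1 → VE E ω z < VI E h μ z) :
    polarAngle y.1.1 = polarAngle x.1.1 + (thetaBar E h μ ω (action x) : Real.Angle) := by
  rw [X.polarAngle_inner hμ hω hK hE hV, X.polarAngle_outer hω hE, thetaBar,
    Real.Angle.coe_add, add_assoc]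

lemma Excursion.length_eq (X : Excursion E h μ ω x y) (hμ : 0 < μ) (hω : 0 < ω)
    (hK : 0 < E + h) (hE : ω ^ 2 / 2 < E) (hV : ∀ z : ℂ, ‖z‖ = 1 → VE E ω z < VI E h μ z) :
    X.length = outerLength E ω (action x) + innerLength E h μ (action x) := by
  have hI := x.action_mem
  have hI2 := sq_lt_of_VE_lt_VI hV (sq_lt_of_mem hI)
  rw [Excursion.length, X.outer.jacobiLength_eq hω (radialVelocity_pos hI) (radialVelocity_sq hI)
    X.start_velocity, X.inner_arc.jacobiLength_eq hK hμ (innerRadial_pos hI2) (innerRadial_sq hI2)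
    (X.inner_start_im hω hE hV)]
  rfl

/-- The inequality `V_E < V_I` makes refraction into the disk always possible. On the way out, the
conserved action still lies below the critical one, so total reflection does not occur. -/
lemma exists_excursion (hμ : 0 < μ) (hω : 0 < ω)
    (hK : 0 < E + h) (hE : ω ^ 2 / 2 < E) (hV : ∀ z : ℂ, ‖z‖ = 1 → VE E ω z < VI E h μ z)
    (x : OutState E ω) : ∃ y, Nonempty (Excursion E h μ ω x y) := by
  have hI := x.action_mem
  have hI2 := sq_lt_of_VE_lt_VI hV (sq_lt_of_mem hI)
  obtain ⟨TE, zE, vE, HE, hzE, hvE⟩ := exists_outerArc hω (radialVelocity_pos hI)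
    (radialVelocity_sq hI) x.2.1
  obtain ⟨TI, zI, vI, HI, hzI, hvI⟩ := exists_innerArc hK hμ (innerRadial_pos hI2)
    (innerRadial_sq hI2) HE.finish
  have hs0 := HE.finish_im hω (radialVelocity_pos hI) (radialVelocity_sq hI) (by rw [hvE, hzE])
  set y := mkState (zI TI) HI.finish (action x) hI with hy
  refine ⟨y, ⟨TE, TI, zE, vE, zI, vI, HE, HI, hzE, ?_, hzI, ?_, rfl, ?_⟩⟩
  · rw [hvE]; exact x.vel_eq.symm
  · rw [snell_iff (VE_pos hE HE.finish) (VI_pos hE hV HE.finish) HE.energy_finish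
      (hzI ▸ HI.energy_start), hs0, hvI]
  · rw [snell_iff (VE_pos hE HI.finish) (VI_pos hE hV HI.finish) y.2.2.1 HI.energy_finish,
      HI.momentum_im (right_mem_Icc.mpr HI.pos.le), hzI, hvI]
    have h1 : (conj (zI TI) * y.1.2).im / √2 = action x := by
      rw [← action_mkState (zI TI) HI.finish (action x) hI]; exact (action_eq y).symm
    rw [div_eq_iff (by positivity)] at h1
    rw [h1, mul_comm]

end Excursions

/-! ### Derivatives of the lengths -/

lemma hasDerivAt_sqrt_two_mul_sqrt {B I : ℝ} (hI : I ^ 2 < B) :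
    HasDerivAt (fun I => √2 * √(B - I ^ 2)) (√2 * (-I / √(B - I ^ 2))) I :=
  (hasDerivAt_sqrt_sub_sq hI).const_mul √2

lemma hasDerivAt_outerTime {E ω a : ℝ} (hω : 0 < ω) (ha : 0 < a) :
    HasDerivAt (outerTime E ω) ((ω ^ 2 - E) / ((ω ^ 2 - E) ^ 2 + ω ^ 2 * a ^ 2)) a := by
  have h1 : HasDerivAt (outerPhase E ω) ((ω : ℂ) * Complex.I) a := by
    have h2 := (((hasDerivAt_id a).const_mul ω).ofReal_comp.mul_const Complex.I).const_add
      ((ω ^ 2 - E : ℝ) : ℂ)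
    refine HasDerivAt.congr_deriv h2 ?_
    simp
  have hslit : outerPhase E ω a ∈ Complex.slitPlane := by
    rw [Complex.mem_slitPlane_iff, outerPhase_im]
    exact Or.inr (mul_pos hω ha).ne'
  have h3 := (Complex.imCLM.hasFDerivAt.comp_hasDerivAt a (h1.clog_real hslit)).div_const ω
  have h4 : outerTime E ω = fun a => (Complex.log (outerPhase E ω a)).im / ω :=
    funext fun a => by rw [outerTime, Complex.log_im]
  rw [h4]
  refine HasDerivAt.congr_deriv h3 ?_
  rw [Complex.imCLM_apply, Complex.div_im, Complex.normSq_apply, outerPhase_re, outerPhase_im]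
  have h5 : 0 < (ω ^ 2 - E) ^ 2 + ω ^ 2 * a ^ 2 := by positivity
  have h6 : (ω ^ 2 - E) * (ω ^ 2 - E) + ω * a * (ω * a) = (ω ^ 2 - E) ^ 2 + ω ^ 2 * a ^ 2 := by
    ring
  rw [h6]
  simp
  field_simp

/-- The derivative is `I` times that of `f`; with its analogue for `innerLength` and `g`, this is
what makes the action conjugate to the angle. -/
lemma hasDerivAt_outerLength {E ω I : ℝ} (hω : 0 < ω) (hI : I ^ 2 < E - ω ^ 2 / 2) :
    HasDerivAt (outerLength E ω) (I * ((2 * E * (E - ω ^ 2 / 2) - 2 * ω ^ 2 * I ^ 2) /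
      (√(E - ω ^ 2 / 2 - I ^ 2) * (E ^ 2 - 2 * ω ^ 2 * I ^ 2)))) I := by
  have hE0 : 0 < E := by nlinarith [sq_nonneg I]
  have hs := Real.sqrt_pos.mpr (sub_pos.mpr hI)
  have hs2 := Real.sq_sqrt (sub_pos.mpr hI).le
  have h2 : √2 ^ 2 = 2 := Real.sq_sqrt (by norm_num)
  have h20 : 0 < √2 := by positivity
  have hN := shift_modulus_pos hE0 hI
  rw [show E ^ 2 + 4 * (E - ω ^ 2 / 2 - E) * I ^ 2 = E ^ 2 - 2 * ω ^ 2 * I ^ 2 by ring] at hN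
  have hr : HasDerivAt (radialVelocity E ω) (√2 * (-I / √(E - ω ^ 2 / 2 - I ^ 2))) I := by
    rw [funext (radialVelocity_eq E ω)]; exact hasDerivAt_sqrt_two_mul_sqrt hI
  have ha : 0 < radialVelocity E ω I := by rw [radialVelocity_eq]; positivity
  have h1 := ((((hasDerivAt_outerTime (E := E) hω ha).comp I hr).const_mul E).sub hr).div_const √2
  refine HasDerivAt.congr_deriv h1 ?_
  have h3 : (ω ^ 2 - E) ^ 2 + ω ^ 2 * radialVelocity E ω I ^ 2 = E ^ 2 - 2 * ω ^ 2 * I ^ 2 := by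
    rw [radialVelocity_eq, mul_pow, h2, hs2]; ring
  rw [h3]
  generalize √(E - ω ^ 2 / 2 - I ^ 2) = s at *
  obtain ⟨N, hNe⟩ : ∃ N, N = E ^ 2 - 2 * ω ^ 2 * I ^ 2 := ⟨_, rfl⟩
  rw [← hNe] at hN ⊢
  field_simp
  rw [hNe]
  ring

lemma hasDerivAt_innerLength {E h μ I : ℝ} (hK : 0 < E + h) (hμ : 0 < μ)
    (hI : I ^ 2 < E + h + μ) :
    HasDerivAt (innerLength E h μ)
      (I * (-2 * (2 * μ * (E + h + μ) + 4 * (E + h) * I ^ 2) /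
        (√(E + h + μ - I ^ 2) * (μ ^ 2 + 4 * (E + h) * I ^ 2)))) I := by
  have hb0 := innerRadial_pos hI
  have hb := innerRadial_sq hI
  have hs := Real.sqrt_pos.mpr (sub_pos.mpr hI)
  have hs2 := Real.sq_sqrt (sub_pos.mpr hI).le
  have h2 : √2 ^ 2 = 2 := Real.sq_sqrt (by norm_num)
  have h20 : 0 < √2 := by positivity
  have hN := shift_modulus_pos hμ hI
  rw [show μ ^ 2 + 4 * (E + h + μ - μ) * I ^ 2 = μ ^ 2 + 4 * (E + h) * I ^ 2 by ring] at hN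
  have hD := Real.sqrt_pos.mpr hN
  have hD2 := Real.sq_sqrt hN.le
  have hk : 0 < √(2 * (E + h)) := Real.sqrt_pos.mpr (by positivity)
  have hk2 := sqrt_two_mul_sq hK
  have hr : HasDerivAt (innerRadial E h μ) (√2 * (-I / √(E + h + μ - I ^ 2))) I := by
    rw [funext (innerRadial_eq E h μ)]; exact hasDerivAt_sqrt_two_mul_sqrt hI
  have hm : HasDerivAt (fun I => kepMod (E + h) μ (√2 * I))
      (4 * (E + h) * I / √(μ ^ 2 + 4 * (E + h) * I ^ 2)) I := by
    rw [funext (kepMod_eq (E + h) μ)]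
    refine ((((hasDerivAt_pow 2 I).const_mul (4 * (E + h))).const_add (μ ^ 2)).sqrt
      hN.ne').congr_deriv ?_
    field_simp
    norm_num
  have hD' : kepMod (E + h) μ (√2 * I) = √(μ ^ 2 + 4 * (E + h) * I ^ 2) := kepMod_eq _ _ _
  have hy := ((hr.const_mul √(2 * (E + h))).div hm (by rw [hD']; exact hD.ne')).arsinh
  have h1 := (hr.add ((hy.const_mul μ).div_const √(2 * (E + h)))).const_mul √2
  refine HasDerivAt.congr_deriv h1 ?_
  have hc := cosh_kepExit hK hμ hb
  rw [kepExit, Real.cosh_arsinh] at hc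
  simp only [Pi.div_apply]
  rw [hc, hD', innerRadial_eq, smul_eq_mul]
  have hM : I ^ 2 = E + h + μ - √(E + h + μ - I ^ 2) ^ 2 := by linarith
  generalize √(μ ^ 2 + 4 * (E + h) * I ^ 2) = D at *
  rw [← hD2]
  generalize √(E + h + μ - I ^ 2) = s at *
  generalize √(2 * (E + h)) = k at *
  generalize √2 = r at *
  field_simp
  rw [h2, hD2, hs2]
  ring

/-! ### The generating function -/

/-- Two lifts within `π` of `c` differ by less than `2π`. -/
lemma angle_lift_unique {a b c : ℝ} (h : (a : Real.Angle) = b) (ha : |a - c| < Real.pi)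
    (hb : |b - c| < Real.pi) : a = b := by
  obtain ⟨k, hk⟩ := Real.Angle.angle_eq_iff_two_pi_dvd_sub.mp h
  rw [abs_lt] at ha hb
  have hπ := Real.pi_pos
  have h1 : (k : ℝ) < 1 := by nlinarith
  have h2 : (-1 : ℝ) < k := by nlinarith
  have h3 : k = 0 := by
    have h1' : k < 1 := by exact_mod_cast h1
    have h2' : -1 < k := by exact_mod_cast h2
    omega
  rw [h3] at hk
  simp at hk
  linarith

/-- The inverse function theorem recovers the action from the difference of lifted angles, and the
length as a function of that action is the generating function. -/
lemma exists_generatingFunction {E h μ ω : ℝ} (hμ : 0 < μ) (hω : 0 < ω) (hK : 0 < E + h)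
    (hE : ω ^ 2 / 2 < E) (hV : ∀ z : ℂ, ‖z‖ = 1 → VE E ω z < VI E h μ z)
    (ξ₀ : ℝ) {I₀ : ℝ} (hI₀ : I₀ ∈ Ioo (-Ic E ω) (Ic E ω))
    (hd : deriv (thetaBar E h μ ω) I₀ ≠ 0) :
    ∃ J ∈ 𝓝 I₀, ∃ W ∈ 𝓝 ((ξ₀, ξ₀ + thetaBar E h μ ω I₀) : ℝ × ℝ), ∃ S : ℝ × ℝ → ℝ,
      IsGeneratingFunction E h μ ω J W S := by
  set θ := thetaBar E h μ ω with hθ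
  have hθd : ∀ I ∈ Ioo (-Ic E ω) (Ic E ω), ∃ θ', HasDerivAt θ θ' I ∧
      HasDerivAt (fun I => outerLength E ω I + innerLength E h μ I) (I * θ') I := fun I hI => by
    have hI1 := sq_lt_of_mem hI
    have hI2 := sq_lt_of_VE_lt_VI hV hI1
    refine ⟨_, (hasDerivAt_f hE hI1).add (hasDerivAt_g hμ hI2), ?_⟩
    rw [mul_add]
    exact (hasDerivAt_outerLength hω hI1).add (hasDerivAt_innerLength hK hμ hI2)
  have han : AnalyticAt ℝ θ I₀ :=
    (analyticAt_f hE (sq_lt_of_mem hI₀)).add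
      (analyticAt_g hμ (sq_lt_of_VE_lt_VI hV (sq_lt_of_mem hI₀)))
  have hst : HasStrictDerivAt θ (deriv θ I₀) I₀ := han.hasStrictDerivAt
  have hst' := hst.hasStrictFDerivAt_equiv hd
  set e := hst'.toOpenPartialHomeomorph θ with he
  have hecoe : ∀ I, e I = θ I := fun I => by
    rw [he, HasStrictFDerivAt.toOpenPartialHomeomorph_coe]
  have hes : I₀ ∈ e.source := hst'.mem_toOpenPartialHomeomorph_source
  have het : θ I₀ ∈ e.target := hst'.image_mem_toOpenPartialHomeomorph_target
  -- The bound by `π` ensures that the angle difference modulo `2π` determines its lift, hence the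
  -- action.
  set J : Set ℝ := {I | I ∈ e.source ∧ I ∈ Ioo (-Ic E ω) (Ic E ω) ∧ deriv θ I ≠ 0 ∧
    |θ I - θ I₀| < Real.pi} with hJ
  set W : Set (ℝ × ℝ) := {q | q.2 - q.1 ∈ e.target ∧ e.symm (q.2 - q.1) ∈ J} with hW
  have hJn : J ∈ 𝓝 I₀ := by
    have h1 : ∀ᶠ I in 𝓝 I₀, deriv θ I ≠ 0 := han.deriv.continuousAt.eventually_ne hd
    have h2 : ∀ᶠ I in 𝓝 I₀, |θ I - θ I₀| < Real.pi := by
      have h3 : ContinuousAt (fun I => |θ I - θ I₀|) I₀ :=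
        (han.continuousAt.sub continuousAt_const).abs
      exact h3.eventually_lt_const (by simpa using Real.pi_pos)
    filter_upwards [e.open_source.mem_nhds hes, isOpen_Ioo.mem_nhds hI₀, h1, h2] with I a b c d
    exact ⟨a, b, c, d⟩
  have hesymm : e.symm (θ I₀) = I₀ := by rw [← hecoe]; exact e.left_inv hes
  have hWn : W ∈ 𝓝 ((ξ₀, ξ₀ + θ I₀) : ℝ × ℝ) := by
    have h1 : Tendsto (fun q : ℝ × ℝ => q.2 - q.1) (𝓝 (ξ₀, ξ₀ + θ I₀)) (𝓝 (θ I₀)) := by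
      have h2 : ContinuousAt (fun q : ℝ × ℝ => q.2 - q.1) (ξ₀, ξ₀ + θ I₀) := by fun_prop
      simpa [ContinuousAt] using h2
    have h3 : ∀ᶠ d in 𝓝 (θ I₀), d ∈ e.target ∧ e.symm d ∈ J := by
      have h5 : ∀ᶠ d in 𝓝 (θ I₀), d ∈ e.target := e.open_target.mem_nhds het
      refine h5.and ?_
      have h4 : ContinuousAt e.symm (θ I₀) := e.symm.continuousAt het
      exact h4.preimage_mem_nhds (by rw [hesymm]; exact hJn)
    exact h1.eventually h3
  have hθe : ∀ {d}, d ∈ e.target → θ (e.symm d) = d := fun hd => by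
    rw [← hecoe]; exact e.right_inv hd
  have hact : ∀ q ∈ W, ∀ (x y : OutState E ω) (X : Excursion E h μ ω x y),
      polarAngle x.1.1 = (q.1 : Real.Angle) → polarAngle y.1.1 = (q.2 : Real.Angle) →
      action x ∈ J → action x = e.symm (q.2 - q.1) := by
    intro q hq x y X h1 h2 hx
    have h3 := X.polarAngle_end hμ hω hK hE hV
    rw [h1, h2] at h3
    have h4 : ((q.2 - q.1 : ℝ) : Real.Angle) = (θ (action x) : Real.Angle) := by
      rw [Real.Angle.coe_sub, h3, add_sub_cancel_left]
    have h5 := hq.2.2.2.2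
    rw [hθe hq.1] at h5
    rw [angle_lift_unique h4 h5 hx.2.2.2, ← hecoe, e.left_inv hx.1]
  refine ⟨J, hJn, W, hWn,
    fun q => outerLength E ω (e.symm (q.2 - q.1)) + innerLength E h μ (e.symm (q.2 - q.1)),
    ⟨fun q hq => ?_, fun q hq x y X h1 h2 hx => ?_, fun q hq x y ⟨X⟩ h1 h2 hx => ?_⟩⟩
  · set x : OutState E ω := mkState ((q.1 : Real.Angle).toCircle) (Circle.norm_coe _)
      (e.symm (q.2 - q.1)) hq.2.2.1 with hx
    have hxa : action x = e.symm (q.2 - q.1) := action_mkState _ _ _ _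
    obtain ⟨y, ⟨X⟩⟩ := exists_excursion hμ hω hK hE hV x
    have hxp : polarAngle x.1.1 = (q.1 : Real.Angle) := polarAngle_toCircle _
    refine ⟨x, y, ⟨X⟩, hxp, ?_, by rw [hxa]; exact hq.2⟩
    rw [X.polarAngle_end hμ hω hK hE hV, hxp, hxa, ← Real.Angle.coe_add]
    congr 1
    change q.1 + θ _ = _
    rw [hθe hq.1]; ring
  · rw [X.length_eq hμ hω hK hE hV, hact q hq x y X h1 h2 hx]
  · have hI := hact q hq x y X h1 h2 hx
    obtain ⟨θ', hθ1, hθ2⟩ := hθd _ hq.2.2.1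
    have hne : θ' ≠ 0 := by
      have := hq.2.2.2.1
      rwa [hθ1.deriv] at this
    have h3 : HasDerivAt e.symm θ'⁻¹ (q.2 - q.1) :=
      e.hasDerivAt_symm hq.1 hne (by rw [funext hecoe]; exact hθ1)
    -- Here the derivative `I θ'` of the length meets the derivative `1 / θ'` of the inverse shift,
    -- leaving the action `I`.
    have h4 := hθ2.comp (q.2 - q.1) h3
    have h5 : HasFDerivAt (fun q : ℝ × ℝ => q.2 - q.1)
        (ContinuousLinearMap.snd ℝ ℝ ℝ - ContinuousLinearMap.fst ℝ ℝ ℝ) q :=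
      hasFDerivAt_snd.sub hasFDerivAt_fst
    have h6 := h4.comp_hasFDerivAt q h5
    refine HasFDerivAt.congr_fderiv h6 ?_
    rw [X.action_eq_action hω hE hV, hI, mul_assoc, mul_inv_cancel₀ hne, mul_one]
    refine ContinuousLinearMap.ext fun w => ?_
    simp
    ring

end

end RefractiveBilliard

end

open RefractiveBilliard in
/-- Circular domains: the first return map of the refractive billiard is an integrable shift. -/
theorem mainTheorem1 (E h μ ω : ℝ) (hμ : 0 < μ) (hω : 0 < ω) (hEh : 0 < E + h)
    (hE : ω ^ 2 / 2 < E) (hV : ∀ z : ℂ, ‖z‖ = 1 → VE E ω z < VI E h μ z) :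
    -- action-angle coordinates and the first return map `F`
    (∃ (Φ : OutState E ω ≃ₜ Real.Angle × Set.Ioo (-Ic E ω) (Ic E ω))
       (F : OutState E ω → OutState E ω),
      (∀ x, (Φ x).1 = polarAngle x.1.1) ∧
      (∀ x, ((Φ x).2 : ℝ) = action x) ∧
      (∀ x y, Nonempty (Excursion E h μ ω x y) ↔ y = F x) ∧
      (∀ (ξ : Real.Angle) (I : Set.Ioo (-Ic E ω) (Ic E ω)),
        Φ (F (Φ.symm (ξ, I))) = (ξ + (thetaBar E h μ ω I : Real.Angle), I))) ∧
    -- `f` is the shift along the outer arcs, and `g` the shift along the inner arcs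
    (∀ (x y : OutState E ω) (X : Excursion E h μ ω x y),
      polarAngle (X.zE X.TE) = polarAngle x.1.1 + (f E ω (action x) : Real.Angle) ∧
      polarAngle y.1.1 = polarAngle (X.zE X.TE) + (g E h μ (action x) : Real.Angle)) ∧
    -- the coordinates are the canonical ones given by the generating function
    (∀ ξ₀ : ℝ, ∀ I₀ ∈ Set.Ioo (-Ic E ω) (Ic E ω), deriv (thetaBar E h μ ω) I₀ ≠ 0 →
      ∃ J ∈ 𝓝 I₀, ∃ W ∈ 𝓝 ((ξ₀, ξ₀ + thetaBar E h μ ω I₀) : ℝ × ℝ), ∃ S : ℝ × ℝ → ℝ,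
        IsGeneratingFunction E h μ ω J W S) ∧
    -- regularity of the shifts
    AnalyticOnNhd ℝ (f E ω) (Set.Ioo (-Ic E ω) (Ic E ω)) ∧
    AnalyticOnNhd ℝ (g E h μ) (Set.Ioo (-Ic E ω) (Ic E ω)) ∧
    -- the critical points
    (∃ P : Polynomial ℝ, P.natDegree = 5 ∧
      ∀ I ∈ Set.Ioo (-Ic E ω) (Ic E ω), deriv (thetaBar E h μ ω) I = 0 → P.eval (I ^ 2) = 0) ∧
    {I ∈ Set.Ioo (-Ic E ω) (Ic E ω) | deriv (thetaBar E h μ ω) I = 0}.encard ≤ 10 := by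
  refine ⟨?_, fun x y X => ⟨X.polarAngle_outer hω hE, X.polarAngle_inner hμ hω hEh hE hV⟩,
    fun ξ₀ I₀ hI₀ hd => exists_generatingFunction hμ hω hEh hE hV ξ₀ hI₀ hd,
    fun I hI => analyticAt_f hE (sq_lt_of_mem hI),
    fun I hI => analyticAt_g hμ (sq_lt_of_VE_lt_VI hV (sq_lt_of_mem hI)),
    exists_critical_polynomial hμ hω hEh hE hV, ?_⟩
  · refine ⟨actionAngle, fun x => actionAngle.symm
      (polarAngle x.1.1 + (thetaBar E h μ ω (action x) : Real.Angle), ⟨action x, x.action_mem⟩),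
      fun x => rfl, fun x => rfl, fun x y => ?_, fun ξ I => ?_⟩
    · have key : ∀ y, Nonempty (Excursion E h μ ω x y) → y = actionAngle.symm
          (polarAngle x.1.1 + (thetaBar E h μ ω (action x) : Real.Angle),
            ⟨action x, x.action_mem⟩) := by
        rintro y ⟨X⟩
        rw [Homeomorph.eq_symm_apply]
        exact Prod.ext (X.polarAngle_end hμ hω hEh hE hV)
          (Subtype.ext (X.action_eq_action hω hE hV))
      refine ⟨key y, ?_⟩
      rintro rfl
      -- Some excursion exists, and `key` forces it to end in the prescribed state.
      obtain ⟨y, hy⟩ := exists_excursion hμ hω hEh hE hV x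
      obtain rfl := key y hy
      exact hy
    · have h1 : (actionAngle (actionAngle.symm (ξ, I))) = (ξ, I) :=
        Homeomorph.apply_symm_apply _ _
      have h2 : polarAngle (actionAngle.symm (ξ, I)).1.1 = ξ := congrArg Prod.fst h1
      have h3 : action (actionAngle.symm (ξ, I)) = I :=
        congrArg (fun q => ((Prod.snd q : Set.Ioo (-Ic E ω) (Ic E ω)) : ℝ)) h1
      rw [Homeomorph.apply_symm_apply]
      refine Prod.ext ?_ (Subtype.ext h3)
      simp only [h2, h3]
  · obtain ⟨P, hP, hcrit⟩ := exists_critical_polynomial hμ hω hEh hE hV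
    have hP0 : P ≠ 0 := by rintro rfl; simp at hP
    have h1 := encard_setOf_eval_sq_le P hP0
    rw [hP] at h1
    refine (Set.encard_le_encard fun I hI => hcrit I hI.1 hI.2).trans (h1.trans ?_)
    norm_num
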